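/- Let $n\ge 1$ be an integer, let $1\le p<\infty$ and let $a,b,c,t\in\mathbb{R}$. Let $\mathbb{B}_n$ be the open unit ball of $\mathbb{C}^n$, let $dV$ be Lebesgue measure, and write $w\overline{z}=\sum_{i=1}^n w_i\overline{z_i}$ and $$\Delta(w,z)=|1-w\overline{z}|^2-(1-|w|^2)(1-|z|^2).$$ Then the operator $$T_{a,b,c}f(z)=\int_{\mathbb{B}_n}\frac{(1-|z|^2)^a(1-|w|^2)^b\left(\sqrt{\Delta(w,z)}\right)^c}{|1-w\overline{z}|^{n+1+a+b+c}}\,f(w)\,dV(w)$$ is bounded on $L^p\left(\mathbb{B}_n;(1-|w|^2)^t\,dV(w)\right)$ if and only if $$c>-2n\quad\text{and}\quad -pa<t+1<p(b+1).$$ Here "bounded" means that there is a constant $C$ such that for every $f$ in this $L^p$ space the integral defining $T_{a,b,c}f(z)$ converges absolutely for almost every $z\in\mathbb{B}_n$, and $T_{a,b,c}f$ belongs to the same space with norm at most $C\|f\|$. -/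

import Mathlib

open MeasureTheory
open scoped ENNReal NNReal

namespace BallKernel

noncomputable section

/-- `ℂⁿ` with its Hermitian norm. -/
abbrev Cn (n : ℕ) : Type := EuclideanSpace ℂ (Fin n)

/-- The open unit ball of `ℂⁿ`. -/
def unitBall (n : ℕ) : Set (Cn n) := Metric.ball 0 1

/-- `w z̄ = ∑ i, w i * conj (z i)` (Mathlib's inner product is conjugate-linear in its first
argument). -/
def herm {n : ℕ} (w z : Cn n) : ℂ := inner ℂ z w

/-- `Δ(w, z) = |1 - w z̄|² - (1 - |w|²)(1 - |z|²)`. -/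
def delta {n : ℕ} (w z : Cn n) : ℝ :=
  ‖1 - herm w z‖ ^ 2 - (1 - ‖w‖ ^ 2) * (1 - ‖z‖ ^ 2)

/-- Lebesgue measure `dV` on `ℂⁿ ≅ ℝ²ⁿ`, restricted to the unit ball. -/
def ballVolume (n : ℕ) : Measure (Cn n) := (volume : Measure (Cn n)).restrict (unitBall n)

/-- The measure `(1 - |w|²)^t dV(w)` on the unit ball. -/
def weightedVolume (n : ℕ) (t : ℝ) : Measure (Cn n) :=
  (ballVolume n).withDensity fun w => ENNReal.ofReal ((1 - ‖w‖ ^ 2) ^ t)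

/-- The kernel
`(1 - |z|²)^a (1 - |w|²)^b (√Δ(w, z))^c / |1 - w z̄|^(n + 1 + a + b + c)`. -/
def kernel (n : ℕ) (a b c : ℝ) (z w : Cn n) : ℝ :=
  (1 - ‖z‖ ^ 2) ^ a * (1 - ‖w‖ ^ 2) ^ b * Real.sqrt (delta w z) ^ c /
    ‖1 - herm w z‖ ^ ((n : ℝ) + 1 + a + b + c)

/-- The operator `T_{a,b,c}`: integration over the ball against the kernel, with respect to `dV`. -/
def opT (n : ℕ) (a b c : ℝ) (f : Cn n → ℂ) (z : Cn n) : ℂ :=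
  ∫ w, (kernel n a b c z w : ℂ) * f w ∂(ballVolume n)

/-- `T_{a,b,c}` is bounded on `L^p(𝔹ₙ; (1 - |w|²)^t dV(w))`: for every `f` in this space the
integral defining `T_{a,b,c} f(z)` converges absolutely for almost every `z` in the ball,
`T_{a,b,c} f` belongs to the space, and its norm is at most `C ‖f‖`, with `C` independent of `f`. -/
def IsBoundedOnLp (n : ℕ) (a b c t p : ℝ) : Prop :=
  ∃ C : ℝ≥0, ∀ f : Cn n → ℂ, MemLp f (ENNReal.ofReal p) (weightedVolume n t) →
    (∀ᵐ z ∂(ballVolume n),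
      Integrable (fun w => (kernel n a b c z w : ℂ) * f w) (ballVolume n)) ∧
    MemLp (opT n a b c f) (ENNReal.ofReal p) (weightedVolume n t) ∧
    eLpNorm (opT n a b c f) (ENNReal.ofReal p) (weightedVolume n t) ≤
      C * eLpNorm f (ENNReal.ofReal p) (weightedVolume n t)

end

end BallKernel

/-!
Since the kernel is nonnegative, boundedness of `T_{a,b,c}` is a statement about nonnegative
functions (`isBoundedOnLp_iff`), and everything below takes place in `[0, ∞]`.

Sufficiency is Schur's test with a power of `1 - |w|²` as test function. It rests on the
Forelli–Rudin estimate
`∫ (1 - |w|²)^B √Δ^c / |1 - w z̄|^(n + 1 + A + B + c) dV(w) ≤ C (1 - |z|²)^(-A)`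
for `A > 0`, `B > -1`, `c > -2n` (`exists_forelliRudin_le`). Where `√Δ ≥ |1 - w z̄| / 2`, the factor
`(√Δ / |1 - w z̄|)^c` is comparable to `1` and the classical estimate applies: integrating out the
variables orthogonal to `z` reduces it to the disc, where polar coordinates turn it into a product
of one-dimensional integrals (`exists_lintegral_disc_le`). Where `√Δ < |1 - w z̄| / 2`, both
`|1 - w z̄|` and `1 - |w|²` are comparable to `ε = 1 - |z|²`, and the integral of `√Δ^c` is computed
by an affine change of variables that takes `√Δ(·, z)` to `ε |u|` with Jacobian `ε^(n + 1)`
(`lintegral_sqrt_delta`); no automorphisms of the ball are needed. For `p > 1` an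
admissible exponent in Schur's test exists exactly when `-pa < t + 1 < p (b + 1)`; for `p = 1` the
exponent `0` is admissible under this condition.

Necessity is shown by test functions. For `c ≤ -2n` the integral diverges at `w = z`, because
`Δ(w, z) ≤ |w - z|²` (`lt_of_bounded`). The image of the indicator function of a small ball
dominates `(1 - |z|²)^a` near the sphere, which forces `-pa < t + 1` (`neg_mul_lt_of_bounded`). For
`p > 1`, truncations of `(1 - |w|²)^(-(b + 1))` force `t + 1 < p (b + 1)`
(`lt_mul_of_bounded_of_one_lt`). For `p = 1` boundedness means a pointwise bound on the adjoint
applied to the weight, and Fatou's lemma carries this bound to a boundary point `e`, where the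
integral `∫ (1 - |z|²)^(a + b) |1 - z ē|^(-(n + 1 + a + b)) dV(z)` diverges (`lt_of_bounded_one`).
-/

namespace BallKernel

/-! ### Orthonormal coordinates and scaling -/

/-- Splitting off the first coordinate, as an isometry `ℂ^(m+1) ≃ ℂ × ℂᵐ` (with the `L²` norm on
the product). -/
noncomputable def splitFirst (m : ℕ) : Cn (m + 1) ≃ₗᵢ[ℝ] WithLp 2 (ℂ × Cn m) where
  toFun w := WithLp.toLp 2 (w 0, WithLp.toLp 2 fun i => w i.succ)
  invFun q := WithLp.toLp 2 (Fin.cons q.fst fun i => q.snd i)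
  map_add' w w' := rfl
  map_smul' s w := rfl
  left_inv w := by
    ext i
    refine Fin.cases ?_ (fun j => ?_) i <;> simp
  right_inv q := by
    simp
    rfl
  norm_map' w := by
    have h : ‖WithLp.toLp 2 (w 0, (WithLp.toLp 2 fun i : Fin m => w i.succ : Cn m))‖ ^ 2 =
        ‖w‖ ^ 2 := by
      rw [WithLp.prod_norm_sq_eq_of_L2, EuclideanSpace.norm_sq_eq, EuclideanSpace.norm_sq_eq,
        Fin.sum_univ_succ]
      rfl
    exact (pow_left_inj₀ (norm_nonneg _) (norm_nonneg _) two_ne_zero).1 h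

theorem exists_orthonormalBasis_zero {m : ℕ} (e : Cn (m + 1)) (he : ‖e‖ = 1) :
    ∃ b : OrthonormalBasis (Fin (m + 1)) ℂ (Cn (m + 1)), b 0 = e := by
  have h : Orthonormal ℂ (({0} : Set (Fin (m + 1))).domRestrict fun _ => e) := by
    rw [orthonormal_iff_ite]
    rintro ⟨i, hi⟩ ⟨j, hj⟩
    obtain rfl : i = 0 := hi
    obtain rfl : j = 0 := hj
    simp [inner_self_eq_norm_sq_to_K, he]
  obtain ⟨b, hb⟩ := h.exists_orthonormalBasis_extension_of_card_eq (by simp)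
  exact ⟨b, hb 0 rfl⟩

/-- In the orthonormal coordinates `w = l e + v` with `v ⊥ e`, a function of `w ē` and `|w|²`
integrates as an iterated integral over `ℂ × ℂᵐ`. -/
theorem lintegral_slice {m : ℕ} (e : Cn (m + 1)) (he : ‖e‖ = 1) (F : ℂ × ℝ → ℝ≥0∞)
    (hF : Measurable F) :
    ∫⁻ w : Cn (m + 1), F (herm w e, ‖w‖ ^ 2) =
      ∫⁻ l : ℂ, ∫⁻ v : Cn m, F (l, ‖l‖ ^ 2 + ‖v‖ ^ 2) := by
  obtain ⟨b, rfl⟩ := exists_orthonormalBasis_zero e he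
  have h1 : MeasurePreserving b.repr (volume : Measure (Cn (m + 1))) volume :=
    { measurable := b.repr.continuous.measurable
      map_eq := by
        let R : Cn (m + 1) ≃ₗᵢ[ℝ] Cn (m + 1) :=
          { toLinearEquiv := b.repr.toLinearEquiv.restrictScalars ℝ
            norm_map' := b.repr.norm_map }
        exact R.measurePreserving.map_eq }
  have h2 := (WithLp.volume_preserving_ofLp ℂ (Cn m)).comp
    ((splitFirst m).measurePreserving.comp h1)
  have hG : Measurable fun q : ℂ × Cn m => F (q.1, ‖q.1‖ ^ 2 + ‖q.2‖ ^ 2) := by fun_prop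
  calc ∫⁻ w : Cn (m + 1), F (herm w (b 0), ‖w‖ ^ 2)
      = ∫⁻ w : Cn (m + 1), (fun q : ℂ × Cn m => F (q.1, ‖q.1‖ ^ 2 + ‖q.2‖ ^ 2))
          ((WithLp.ofLp ∘ splitFirst m ∘ b.repr) w) := by
        refine lintegral_congr fun w => ?_
        have h3 : ‖w‖ ^ 2 = ‖b.repr w 0‖ ^ 2 +
            ‖(WithLp.toLp 2 fun i : Fin m => b.repr w i.succ : Cn m)‖ ^ 2 := by
          rw [← b.repr.norm_map w, EuclideanSpace.norm_sq_eq, EuclideanSpace.norm_sq_eq,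
            Fin.sum_univ_succ]
        have h4 : herm w (b 0) = b.repr w 0 := by
          rw [b.repr_apply_apply]; rfl
        rw [h3, h4]
        rfl
    _ = ∫⁻ q : ℂ × Cn m, F (q.1, ‖q.1‖ ^ 2 + ‖q.2‖ ^ 2) := h2.lintegral_comp hG
    _ = _ := by
      rw [Measure.volume_eq_prod, lintegral_prod _ hG.aemeasurable]

/-- A unit vector in the direction of `z`, an arbitrary one if `z = 0`. -/
theorem exists_unit_smul {m : ℕ} (z : Cn (m + 1)) :
    ∃ e : Cn (m + 1), ‖e‖ = 1 ∧ ∀ w, herm w z = (‖z‖ : ℂ) * herm w e := by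
  by_cases hz : z = 0
  · exact ⟨EuclideanSpace.single 0 1, by simp, fun w => by simp [hz, herm]⟩
  · have h0 : (‖z‖ : ℂ) ≠ 0 := by simpa using hz
    refine ⟨(‖z‖ : ℂ)⁻¹ • z, by simp [norm_smul, hz], fun w => ?_⟩
    simp only [herm, inner_smul_left]
    simp [hz]

theorem lintegral_eq_scaled {E : Type*} [NormedAddCommGroup E] [NormedSpace ℝ E]
    [MeasurableSpace E] [BorelSpace E] [FiniteDimensional ℝ E] (μ : Measure E)
    [μ.IsAddHaarMeasure] {R : ℝ} (hR : 0 < R) (f : E → ℝ≥0∞) :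
    ∫⁻ x, f x ∂μ = ENNReal.ofReal (R ^ Module.finrank ℝ E) * ∫⁻ x, f (R • x) ∂μ := by
  have h := Measure.map_addHaar_smul μ hR.ne'
  have he : MeasurableEmbedding fun x : E => R • x :=
    (Homeomorph.smulOfNeZero R hR.ne').measurableEmbedding
  rw [← he.lintegral_map, h, lintegral_smul_measure, smul_eq_mul, ← mul_assoc,
    ← ENNReal.ofReal_mul (by positivity), abs_of_pos (by positivity),
    mul_inv_cancel₀ (by positivity)]
  simp

/-! ### Radial integrals and the Forelli–Rudin integral on the disc -/

/-- The truncated power `x ↦ x ^ s` for `x > 0` and `0` otherwise, with values in `[0, ∞]`. A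
weight `(1 - |w|²) ^ s` on the ball is `posPow s (1 - |w|²)` on the whole space. -/
noncomputable def posPow (s x : ℝ) : ℝ≥0∞ := if 0 < x then ENNReal.ofReal (x ^ s) else 0

theorem posPow_of_pos {s x : ℝ} (hx : 0 < x) : posPow s x = ENNReal.ofReal (x ^ s) := if_pos hx

theorem posPow_of_nonpos {s x : ℝ} (hx : x ≤ 0) : posPow s x = 0 := if_neg hx.not_gt

@[fun_prop]
theorem measurable_posPow (s : ℝ) : Measurable (posPow s) :=
  Measurable.ite measurableSet_Ioi (by fun_prop) measurable_const

theorem posPow_mul {s x y : ℝ} (hx : 0 < x) : posPow s (x * y) = posPow s x * posPow s y := by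
  by_cases hy : 0 < y
  · rw [posPow_of_pos hx, posPow_of_pos hy, posPow_of_pos (mul_pos hx hy),
      Real.mul_rpow hx.le hy.le, ENNReal.ofReal_mul (by positivity)]
  · rw [posPow_of_nonpos (not_lt.1 hy),
      posPow_of_nonpos (mul_nonpos_of_nonneg_of_nonpos hx.le (not_lt.1 hy)), mul_zero]

/-- Comparable positive numbers have comparable powers, whatever the sign of the exponent. -/
theorem rpow_le_of_comparable {x y k : ℝ} (s : ℝ) (hx : 0 < x) (hy : 0 < y) (hxy : x ≤ k * y)
    (hyx : y ≤ k * x) : x ^ s ≤ k ^ |s| * y ^ s := by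
  have hk : 0 < k := pos_of_mul_pos_left (hx.trans_le hxy) hy.le
  rcases le_total 0 s with hs | hs
  · rw [abs_of_nonneg hs, ← Real.mul_rpow hk.le hy.le]
    exact Real.rpow_le_rpow hx.le hxy hs
  · rw [abs_of_nonpos hs]
    have h : (k * x) ^ s ≤ y ^ s := Real.rpow_le_rpow_of_nonpos hy hyx hs
    rw [Real.mul_rpow hk.le hx.le] at h
    calc x ^ s = k ^ (-s) * (k ^ s * x ^ s) := by
          rw [← mul_assoc, ← Real.rpow_add hk, neg_add_cancel, Real.rpow_zero, one_mul]
      _ ≤ k ^ (-s) * y ^ s := by gcongr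

theorem posPow_one_sub_sq_le {s x : ℝ} (hx : 0 ≤ x) :
    posPow s (1 - x ^ 2) ≤ ENNReal.ofReal (2 ^ |s|) * posPow s (1 - x) := by
  by_cases h : x < 1
  · have h1 : 0 < 1 - x := by linarith
    have h2 : 0 < 1 - x ^ 2 := by nlinarith
    rw [posPow_of_pos h1, posPow_of_pos h2, ← ENNReal.ofReal_mul (by positivity)]
    exact ENNReal.ofReal_le_ofReal
      (rpow_le_of_comparable s h2 h1 (by nlinarith) (by nlinarith))
  · rw [posPow_of_nonpos (by nlinarith)]
    exact zero_le

theorem mem_unitBall {m : ℕ} {v : Cn m} : v ∈ unitBall m ↔ ‖v‖ < 1 := by simp [unitBall]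

theorem measurableSet_unitBall (m : ℕ) : MeasurableSet (unitBall m) :=
  Metric.isOpen_ball.measurableSet

theorem one_sub_norm_sq_pos {m : ℕ} {v : Cn m} (hv : v ∈ unitBall m) : 0 < 1 - ‖v‖ ^ 2 := by
  have h := mem_unitBall.1 hv
  nlinarith [norm_nonneg v]

theorem finrank_real_cn (m : ℕ) : Module.finrank ℝ (Cn m) = 2 * m := by
  rw [← Module.finrank_mul_finrank ℝ ℂ, Complex.finrank_real_complex, finrank_euclideanSpace_fin]

theorem lintegral_ne_top_iff_integrableOn {α : Type*} [MeasurableSpace α] {μ : Measure α}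
    {s : Set α} {f : α → ℝ} (hf : Measurable f) (h0 : ∀ x ∈ s, 0 ≤ f x) (hs : MeasurableSet s) :
    ∫⁻ x in s, ENNReal.ofReal (f x) ∂μ ≠ ∞ ↔ IntegrableOn f s μ :=
  lintegral_ofReal_ne_top_iff_integrable hf.aestronglyMeasurable
    ((ae_restrict_iff' hs).2 (.of_forall h0))

theorem setLIntegral_posPow_eq {m : ℕ} (s : ℝ) (g : Cn m → ℝ≥0∞) :
    ∫⁻ v : Cn m, posPow s (1 - ‖v‖ ^ 2) * g v =
      ∫⁻ v in unitBall m, ENNReal.ofReal ((1 - ‖v‖ ^ 2) ^ s) * g v := by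
  rw [← lintegral_indicator (measurableSet_unitBall m)]
  refine lintegral_congr fun v => ?_
  by_cases hv : v ∈ unitBall m
  · rw [Set.indicator_of_mem hv, posPow_of_pos (one_sub_norm_sq_pos hv)]
  · have h : 1 ≤ ‖v‖ := not_lt.1 (mem_unitBall.not.1 hv)
    rw [Set.indicator_of_notMem hv, posPow_of_nonpos (by nlinarith [norm_nonneg v]), zero_mul]

theorem integrableOn_one_sub_rpow_iff {s δ : ℝ} (hδ : 0 < δ) :
    IntegrableOn (fun y : ℝ => (1 - y) ^ s) (Set.Ioo (1 - δ) 1) ↔ -1 < s := by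
  rw [← intervalIntegral.integrableOn_Ioo_rpow_iff hδ]
  have h := (Measure.measurePreserving_sub_left (volume : Measure ℝ) 1)
  have he : MeasurableEmbedding fun y : ℝ => 1 - y :=
    (Homeomorph.subLeft (1 : ℝ)).measurableEmbedding
  rw [← h.integrableOn_comp_preimage he]
  simp [Function.comp_def]

theorem integrableOn_unitBall_fun_norm_iff {m : ℕ} (f : ℝ → ℝ) :
    IntegrableOn (fun v : Cn (m + 1) => f ‖v‖) (unitBall (m + 1)) ↔
      IntegrableOn (fun y : ℝ => y ^ (2 * m + 1) * f y) (Set.Ioo 0 1) := by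
  have h := integrableOn_fun_norm_addHaar (volume : Measure (Cn (m + 1))) (f := f) (r := 1)
  rw [finrank_real_cn, show 2 * (m + 1) - 1 = 2 * m + 1 by omega] at h
  exact h

/-- The weight `(1 - |v|²) ^ s` has finite mass on the ball if `s > -1`. -/
theorem lintegral_weight_ne_top (m : ℕ) {s : ℝ} (hs : -1 < s) :
    ∫⁻ v : Cn m, posPow s (1 - ‖v‖ ^ 2) ≠ ∞ := by
  have h := setLIntegral_posPow_eq (m := m) s 1
  simp only [Pi.one_apply, mul_one] at h
  have h0 : ∀ v ∈ unitBall m, 0 ≤ (1 - ‖v‖ ^ 2) ^ s := fun v hv =>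
    Real.rpow_nonneg (one_sub_norm_sq_pos hv).le _
  rw [h, lintegral_ne_top_iff_integrableOn (by fun_prop) h0 (measurableSet_unitBall m)]
  cases m with
  | zero =>
    have : (fun v : Cn 0 => (1 - ‖v‖ ^ 2) ^ s) = fun _ => 1 := by
      funext v
      simp [Subsingleton.elim v 0]
    rw [this]
    exact integrableOn_const (by simp [unitBall])
  | succ m =>
    rw [integrableOn_unitBall_fun_norm_iff (fun y => (1 - y ^ 2) ^ s)]
    have h1 := ((integrableOn_one_sub_rpow_iff (s := s) one_pos).2 hs).const_mul (2 ^ |s|)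
    rw [sub_self] at h1
    refine Integrable.mono' h1
      (by fun_prop : Measurable fun y : ℝ => y ^ (2 * m + 1) * (1 - y ^ 2) ^ s).aestronglyMeasurable
      ((ae_restrict_iff' measurableSet_Ioo).2
      (.of_forall fun y hy => ?_))
    have hy1 : 0 < 1 - y := by linarith [hy.2]
    have hy2 : 0 < 1 - y ^ 2 := by nlinarith [hy.1, hy.2]
    rw [Real.norm_of_nonneg (mul_nonneg (pow_nonneg hy.1.le _) (by positivity))]
    calc y ^ (2 * m + 1) * (1 - y ^ 2) ^ s ≤ 1 * (1 - y ^ 2) ^ s := by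
          gcongr
          exact pow_le_one₀ hy.1.le hy.2.le
      _ ≤ 2 ^ |s| * (1 - y) ^ s := by
          rw [one_mul]
          exact rpow_le_of_comparable s hy2 hy1 (by nlinarith [hy.1, hy.2])
            (by nlinarith [hy.1, hy.2])

/-- The weight `(1 - |v|²) ^ s` has infinite mass near the sphere if `s ≤ -1`. -/
theorem lintegral_weight_shell_eq_top (m : ℕ) {s : ℝ} (hs : s ≤ -1) :
    ∫⁻ v : Cn (m + 1), (Set.Ioi (1 / 2)).indicator 1 ‖v‖ * posPow s (1 - ‖v‖ ^ 2) = ∞ := by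
  simp_rw [mul_comm _ (posPow _ _)]
  rw [setLIntegral_posPow_eq]
  by_contra hfin
  have h0 : ∀ v : Cn (m + 1), ENNReal.ofReal ((1 - ‖v‖ ^ 2) ^ s) *
      (Set.Ioi (1 / 2)).indicator 1 ‖v‖ = ENNReal.ofReal
        ((Set.Ioi (1 / 2)).indicator (fun y : ℝ => (1 - y ^ 2) ^ s) ‖v‖) := fun v => by
    by_cases hv : ‖v‖ ∈ Set.Ioi (1 / 2 : ℝ)
    · rw [Set.indicator_of_mem hv, Set.indicator_of_mem hv, Pi.one_apply, mul_one]
    · rw [Set.indicator_of_notMem hv, Set.indicator_of_notMem hv, mul_zero, ENNReal.ofReal_zero]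
  simp_rw [h0] at hfin
  have hm : Measurable ((Set.Ioi (1 / 2)).indicator (fun y : ℝ => (1 - y ^ 2) ^ s)) :=
    (by fun_prop : Measurable fun y : ℝ => (1 - y ^ 2) ^ s).indicator measurableSet_Ioi
  change ¬ (_ = _) at hfin
  rw [← ne_eq, lintegral_ne_top_iff_integrableOn (f := fun v : Cn (m + 1) => (Set.Ioi (1 / 2)).indicator
    (fun y : ℝ => (1 - y ^ 2) ^ s) ‖v‖) (hm.comp measurable_norm) (fun v hv => ?_)
    (measurableSet_unitBall _), integrableOn_unitBall_fun_norm_iff] at hfin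
  · have hI : IntegrableOn (fun y : ℝ => y ^ (2 * m + 1) * (1 - y ^ 2) ^ s)
        (Set.Ioo (1 / 2) 1) := by
      refine (hfin.mono_set (Set.Ioo_subset_Ioo_left (by norm_num))).congr_fun ?_ measurableSet_Ioo
      intro y hy
      simp only
      rw [Set.indicator_of_mem (Set.mem_Ioi.2 hy.1)]
    have hlt : ¬ (-1 < s) := by linarith
    refine hlt ((integrableOn_one_sub_rpow_iff (δ := 1 / 2) (by norm_num)).1 ?_)
    norm_num only
    refine Integrable.mono' (hI.const_mul (2 ^ (2 * m + 1) * 2 ^ |s|))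
      (by fun_prop : Measurable fun y : ℝ => (1 - y) ^ s).aestronglyMeasurable
      ((ae_restrict_iff' measurableSet_Ioo).2 (.of_forall fun y hy => ?_))
    have hy0 : 1 / 2 < y := hy.1
    have hy1 : 0 < 1 - y := by linarith [hy.2]
    have hy2 : 0 < 1 - y ^ 2 := by nlinarith [hy.1, hy.2]
    rw [Real.norm_of_nonneg (by positivity)]
    calc (1 - y) ^ s ≤ 2 ^ |s| * (1 - y ^ 2) ^ s :=
          rpow_le_of_comparable s hy1 hy2 (by nlinarith [hy.1, hy.2]) (by nlinarith [hy.1, hy.2])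
      _ ≤ (2 * y) ^ (2 * m + 1) * (2 ^ |s| * (1 - y ^ 2) ^ s) :=
          le_mul_of_one_le_left (by positivity) (one_le_pow₀ (by linarith))
      _ = _ := by rw [mul_pow]; ring
  · exact Set.indicator_apply_nonneg fun _ => Real.rpow_nonneg (one_sub_norm_sq_pos hv).le _

/-- Integrating out the variables orthogonal to a complex line turns the weight of exponent `s`
into the one of exponent `s + m` on that line. -/
theorem lintegral_weight_slice (m : ℕ) (s x : ℝ) :
    ∫⁻ v : Cn m, posPow s (1 - (x + ‖v‖ ^ 2)) =
      posPow (s + m) (1 - x) * ∫⁻ v : Cn m, posPow s (1 - ‖v‖ ^ 2) := by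
  by_cases hx : 0 < 1 - x
  · rw [lintegral_eq_scaled volume (Real.sqrt_pos.2 hx), finrank_real_cn]
    have h : ∀ v : Cn m, posPow s (1 - (x + ‖√(1 - x) • v‖ ^ 2)) =
        posPow s (1 - x) * posPow s (1 - ‖v‖ ^ 2) := fun v => by
      rw [← posPow_mul hx, norm_smul, mul_pow, Real.norm_eq_abs, sq_abs, Real.sq_sqrt hx.le]
      congr 1
      ring
    simp_rw [h]
    rw [lintegral_const_mul _ (by fun_prop), ← mul_assoc, pow_mul, Real.sq_sqrt hx.le,
      posPow_of_pos hx, posPow_of_pos hx, ← ENNReal.ofReal_mul (by positivity),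
      Real.rpow_add hx, Real.rpow_natCast, mul_comm ((1 - x) ^ m)]
  · rw [posPow_of_nonpos (not_lt.1 hx), zero_mul, lintegral_eq_zero_iff (by fun_prop)]
    exact .of_forall fun v => posPow_of_nonpos (by nlinarith [sq_nonneg ‖v‖])

/-- By scaling, the integral equals a multiple of `ε ^ (-δ)`; it converges at `0` because `β > -1`
and at infinity because `δ > 0`. -/
theorem exists_lintegral_rpow_mul_le {β δ : ℝ} (hβ : -1 < β) (hδ : 0 < δ) :
    ∃ C : ℝ≥0∞, C ≠ ∞ ∧ ∀ ε : ℝ, 0 < ε →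
      ∫⁻ x : ℝ, posPow β x * ENNReal.ofReal ((ε + x) ^ (-(1 + β + δ))) ≤
        C * ENNReal.ofReal (ε ^ (-δ)) := by
  refine ⟨∫⁻ x : ℝ, posPow β x * ENNReal.ofReal ((1 + x) ^ (-(1 + β + δ))), ?_, fun ε hε => ?_⟩
  · have h1 : ∫⁻ x in Set.Ioo (0 : ℝ) 1, ENNReal.ofReal (x ^ β) ≠ ∞ := by
      rw [lintegral_ne_top_iff_integrableOn (by fun_prop) (fun x hx => Real.rpow_nonneg hx.1.le _)
        measurableSet_Ioo]
      exact (intervalIntegral.integrableOn_Ioo_rpow_iff one_pos).2 hβ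
    have h2 : ∫⁻ x in Set.Ioi (1 / 2 : ℝ), ENNReal.ofReal (x ^ (-(1 + δ))) ≠ ∞ := by
      rw [lintegral_ne_top_iff_integrableOn (by fun_prop)
        (fun x hx => Real.rpow_nonneg (by have := Set.mem_Ioi.1 hx; linarith) _)
        measurableSet_Ioi]
      exact (integrableOn_Ioi_rpow_iff (by norm_num)).2 (by linarith)
    refine ne_top_of_le_ne_top (ENNReal.add_ne_top.2 ⟨h1, h2⟩) ?_
    rw [← lintegral_indicator measurableSet_Ioo, ← lintegral_indicator measurableSet_Ioi,
      ← lintegral_add_left ((by fun_prop : Measurable fun x : ℝ =>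
        ENNReal.ofReal (x ^ β)).indicator measurableSet_Ioo)]
    refine lintegral_mono fun x => ?_
    rcases le_or_gt x 0 with hx | hx
    · simp [posPow_of_nonpos hx]
    rw [posPow_of_pos hx, ← ENNReal.ofReal_mul (by positivity)]
    rcases lt_or_ge x 1 with hx1 | hx1
    · rw [Set.indicator_of_mem (show x ∈ Set.Ioo (0 : ℝ) 1 from ⟨hx, hx1⟩)]
      refine le_add_right (ENNReal.ofReal_le_ofReal (mul_le_of_le_one_right (by positivity) ?_))
      exact Real.rpow_le_one_of_one_le_of_nonpos (by linarith) (by linarith)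
    · rw [Set.indicator_of_mem (show x ∈ Set.Ioi (1 / 2 : ℝ) by
        simp only [Set.mem_Ioi]; linarith)]
      refine le_add_left (ENNReal.ofReal_le_ofReal ?_)
      calc x ^ β * (1 + x) ^ (-(1 + β + δ)) ≤ x ^ β * x ^ (-(1 + β + δ)) := by
            gcongr ?_ * ?_
            exact Real.rpow_le_rpow_of_nonpos hx (by linarith) (by linarith)
        _ = x ^ (-(1 + δ)) := by
            rw [← Real.rpow_add hx]
            congr 1
            ring
  · rw [lintegral_eq_scaled volume hε]
    have h : ∀ x : ℝ, posPow β (ε • x) * ENNReal.ofReal ((ε + ε • x) ^ (-(1 + β + δ))) =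
        ENNReal.ofReal (ε ^ (-1 - δ)) *
          (posPow β x * ENNReal.ofReal ((1 + x) ^ (-(1 + β + δ)))) := fun x => by
      rcases le_or_gt x 0 with hx | hx
      · rw [posPow_of_nonpos hx, posPow_of_nonpos (x := ε • x)
          (mul_nonpos_of_nonneg_of_nonpos hε.le hx)]
        simp
      · rw [smul_eq_mul, show ε + ε * x = ε * (1 + x) by ring, posPow_mul hε, posPow_of_pos hε,
          Real.mul_rpow hε.le (by linarith), ENNReal.ofReal_mul (by positivity),
          show -1 - δ = β + -(1 + β + δ) by ring, Real.rpow_add hε,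
          ENNReal.ofReal_mul (by positivity)]
        ring
    simp_rw [h]
    rw [lintegral_const_mul _ (by fun_prop), ← mul_assoc, ← ENNReal.ofReal_mul (by positivity),
      mul_comm]
    refine le_of_eq ?_
    congr 2
    rw [Module.finrank_self, pow_one, ← Real.rpow_one_add' hε.le (by linarith)]
    congr 1
    ring

theorem norm_polar_lower_bounds {r ρ θ : ℝ} (hr0 : 0 ≤ r) (hr1 : r < 1) (hρ0 : 0 < ρ)
    (hρ1 : ρ < 1) (hθ : |θ| < Real.pi) :
    (1 - r) + (1 - ρ) ≤ 2 * ‖1 - (r : ℂ) * (ρ * (Real.cos θ + Real.sin θ * Complex.I))‖ ∧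
      (1 - r) + |θ| ≤ 5 * ‖1 - (r : ℂ) * (ρ * (Real.cos θ + Real.sin θ * Complex.I))‖ := by
  have he : (Real.cos θ + Real.sin θ * Complex.I : ℂ) = Complex.exp (Complex.I * θ) := by
    rw [mul_comm Complex.I, Complex.exp_mul_I, Complex.ofReal_cos, Complex.ofReal_sin]
  have hn : ‖Complex.exp (Complex.I * θ)‖ = 1 := by
    rw [mul_comm]; exact Complex.norm_exp_ofReal_mul_I θ
  rw [he]
  set u := Complex.exp (Complex.I * θ) with hu
  set N := ‖1 - (r : ℂ) * (ρ * u)‖ with hN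
  have hnorm : ‖(r : ℂ) * (ρ * u)‖ = r * ρ := by
    rw [norm_mul, norm_mul, hn, Complex.norm_of_nonneg hr0, Complex.norm_of_nonneg hρ0.le, mul_one]
  have h1 : 1 - r * ρ ≤ N := by
    have := norm_sub_norm_le (1 : ℂ) ((r : ℂ) * (ρ * u))
    rwa [hnorm, norm_one] at this
  -- Comparison with the boundary point `u`, where the distance to `1` is explicit.
  have h2 : ‖u - 1‖ ≤ N + (1 - r * ρ) := by
    have hdec : u - 1 = -(1 - (r : ℂ) * (ρ * u)) + ((1 - r * ρ : ℝ) : ℂ) * u := by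
      push_cast; ring
    calc ‖u - 1‖ ≤ ‖-(1 - (r : ℂ) * (ρ * u))‖ + ‖((1 - r * ρ : ℝ) : ℂ) * u‖ := by
          rw [hdec]; exact norm_add_le _ _
      _ = N + (1 - r * ρ) := by
          rw [norm_neg, norm_mul, hn, mul_one, Complex.norm_of_nonneg (by nlinarith)]
  have h3 : 2 / Real.pi * |θ| ≤ ‖u - 1‖ := by
    rw [hu, Complex.norm_exp_I_mul_ofReal_sub_one, norm_mul, Real.norm_eq_abs, Real.norm_eq_abs]
    have := Real.mul_abs_le_abs_sin (x := θ / 2) (by rw [abs_div, abs_two]; linarith)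
    rw [abs_div, abs_two] at this
    rw [abs_two]
    linarith
  have h4 : |θ| ≤ 4 * N := by
    have hpi : (1 / 2 : ℝ) ≤ 2 / Real.pi := by
      rw [div_le_div_iff₀ (by norm_num) Real.pi_pos]
      linarith [Real.pi_le_four]
    have : 1 / 2 * |θ| ≤ 2 / Real.pi * |θ| := by gcongr
    linarith
  constructor
  · nlinarith
  · nlinarith

/-- The Forelli–Rudin estimate on the disc. In polar coordinates `|1 - r ρ e^{iθ}|` dominates both
`(1 - r) + (1 - ρ)` and `(1 - r) + |θ|`; distributing the exponent over the two bounds leaves a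
product of integrals in one variable. -/
theorem exists_lintegral_disc_le {β A : ℝ} (hβ : -1 < β) (hA : 0 < A) :
    ∃ C : ℝ≥0∞, C ≠ ∞ ∧ ∀ r : ℝ, 0 ≤ r → r < 1 →
      ∫⁻ l : ℂ, posPow β (1 - ‖l‖ ^ 2) * ENNReal.ofReal (‖1 - r * l‖ ^ (-(2 + A + β))) ≤
        C * ENNReal.ofReal ((1 - r) ^ (-A)) := by
  obtain ⟨C₁, hC₁, h₁⟩ := exists_lintegral_rpow_mul_le hβ (half_pos hA)
  obtain ⟨C₂, hC₂, h₂⟩ := exists_lintegral_rpow_mul_le (neg_one_lt_zero) (half_pos hA)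
  set P : ℝ := 1 + β + A / 2 with hP
  set Q : ℝ := 1 + 0 + A / 2 with hQ
  have hPpos : 0 < P := by linarith
  have hQpos : 0 < Q := by linarith
  set K : ℝ := 2 ^ |β| * 2 ^ P * 5 ^ Q with hK
  refine ⟨ENNReal.ofReal K * (C₁ * (C₂ + C₂)), by finiteness, fun r hr0 hr1 => ?_⟩
  have hε : 0 < 1 - r := by linarith
  set G₁ : ℝ → ℝ≥0∞ := fun x => posPow β x * ENNReal.ofReal (((1 - r) + x) ^ (-P)) with hG₁
  set G₂ : ℝ → ℝ≥0∞ := fun x => posPow 0 x * ENNReal.ofReal (((1 - r) + x) ^ (-Q)) with hG₂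
  have hG₁m : Measurable G₁ := by fun_prop
  have hG₂m : Measurable G₂ := by fun_prop
  -- `G₂` vanishes on the negative half-line, so `G₂ θ + G₂ (-θ)` is a function of `|θ|` off `0`.
  have hpt : ∀ q ∈ polarCoord.target, q.2 ≠ 0 → ENNReal.ofReal q.1 •
      (posPow β (1 - ‖Complex.polarCoord.symm q‖ ^ 2) *
        ENNReal.ofReal (‖1 - r * Complex.polarCoord.symm q‖ ^ (-(2 + A + β)))) ≤
      ENNReal.ofReal K * (G₁ (1 - q.1) * (G₂ q.2 + G₂ (-q.2))) := by
    rintro ⟨ρ, θ⟩ hq hθ0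
    have hρ : 0 < ρ := hq.1
    have hθ : |θ| < Real.pi := abs_lt.2 hq.2
    rw [Complex.norm_polarCoord_symm, Complex.polarCoord_symm_apply]
    simp only [abs_of_pos hρ]
    -- For `ρ ≥ 1` the truncated weight vanishes.
    rcases lt_or_ge ρ 1 with hρ1 | hρ1
    swap
    · rw [posPow_of_nonpos (by nlinarith)]
      simp
    obtain ⟨b1, b2⟩ := norm_polar_lower_bounds hr0 hr1 hρ hρ1 hθ
    set N := ‖1 - (r : ℂ) * (ρ * (Real.cos θ + Real.sin θ * Complex.I))‖
    have hx : 0 < 1 - ρ := by linarith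
    have ha : 0 < |θ| := abs_pos.2 hθ0
    have hN : 0 < N := by linarith
    have hGθ : G₂ θ + G₂ (-θ) = ENNReal.ofReal (((1 - r) + |θ|) ^ (-Q)) := by
      rcases lt_or_gt_of_ne hθ0 with h | h
      · simp only [hG₂]
        rw [posPow_of_nonpos h.le, posPow_of_pos (by linarith), abs_of_neg h]
        simp
      · simp only [hG₂]
        rw [posPow_of_pos h, posPow_of_nonpos (by linarith), abs_of_pos h]
        simp
    have e1 : N ^ (-P) ≤ 2 ^ P * ((1 - r) + (1 - ρ)) ^ (-P) := by
      rw [Real.rpow_neg hN.le, Real.rpow_neg (by linarith), ← div_eq_mul_inv,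
        inv_le_comm₀ (by positivity) (by positivity), inv_div, div_le_iff₀ (by positivity),
        ← Real.mul_rpow hN.le (by norm_num)]
      exact Real.rpow_le_rpow (by linarith) (by linarith) hPpos.le
    have e2 : N ^ (-Q) ≤ 5 ^ Q * ((1 - r) + |θ|) ^ (-Q) := by
      rw [Real.rpow_neg hN.le, Real.rpow_neg (by linarith), ← div_eq_mul_inv,
        inv_le_comm₀ (by positivity) (by positivity), inv_div, div_le_iff₀ (by positivity),
        ← Real.mul_rpow hN.le (by norm_num)]
      exact Real.rpow_le_rpow (by linarith) (by linarith) hQpos.le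
    have e3 : N ^ (-(2 + A + β)) ≤
        2 ^ P * 5 ^ Q * (((1 - r) + (1 - ρ)) ^ (-P) * ((1 - r) + |θ|) ^ (-Q)) := by
      rw [show -(2 + A + β) = -P + -Q by rw [hP, hQ]; ring, Real.rpow_add hN]
      calc N ^ (-P) * N ^ (-Q)
          ≤ (2 ^ P * ((1 - r) + (1 - ρ)) ^ (-P)) * (5 ^ Q * ((1 - r) + |θ|) ^ (-Q)) := by
            gcongr
        _ = _ := by ring
    rw [hGθ, smul_eq_mul]
    simp only [hG₁]
    calc ENNReal.ofReal ρ * (posPow β (1 - ρ ^ 2) * ENNReal.ofReal (N ^ (-(2 + A + β))))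
        ≤ 1 * ((ENNReal.ofReal (2 ^ |β|) * posPow β (1 - ρ)) * ENNReal.ofReal
            (2 ^ P * 5 ^ Q * (((1 - r) + (1 - ρ)) ^ (-P) * ((1 - r) + |θ|) ^ (-Q)))) := by
          gcongr
          · exact ENNReal.ofReal_le_one.2 hρ1.le
          · exact posPow_one_sub_sq_le hρ.le
      _ = _ := by
          rw [hK, mul_assoc ((2 : ℝ) ^ |β|), ENNReal.ofReal_mul (p := (2 : ℝ) ^ |β|) (by positivity),
            ENNReal.ofReal_mul (p := (2 : ℝ) ^ P * 5 ^ Q) (by positivity),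
            ENNReal.ofReal_mul (p := ((1 - r) + (1 - ρ)) ^ (-P)) (by positivity)]
          ring
  rw [← Complex.lintegral_comp_polarCoord_symm]
  have hne : ∀ᵐ q : ℝ × ℝ, q.2 ≠ 0 := by
    have : (volume : Measure (ℝ × ℝ)) (Set.univ ×ˢ {0}) = 0 := by
      rw [Measure.volume_eq_prod, Measure.prod_prod]
      simp
    refine measure_mono_null ?_ this
    rintro ⟨x, y⟩ h
    simpa using h
  calc _ ≤ ∫⁻ q in polarCoord.target,
          ENNReal.ofReal K * (G₁ (1 - q.1) * (G₂ q.2 + G₂ (-q.2))) := by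
        refine lintegral_mono_ae ?_
        filter_upwards [ae_restrict_mem polarCoord.open_target.measurableSet,
          ae_restrict_of_ae hne] with q hq hq0
        exact hpt q hq hq0
    _ ≤ ∫⁻ q : ℝ × ℝ, ENNReal.ofReal K * (G₁ (1 - q.1) * (G₂ q.2 + G₂ (-q.2))) :=
        setLIntegral_le_lintegral _ _
    _ = ENNReal.ofReal K * ((∫⁻ x, G₁ x) * ((∫⁻ x, G₂ x) + ∫⁻ x, G₂ x)) := by
        rw [lintegral_const_mul _ (by fun_prop), Measure.volume_eq_prod,
          lintegral_prod_mul (f := fun x => G₁ (1 - x)) (g := fun x => G₂ x + G₂ (-x))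
            (by fun_prop) (by fun_prop),
          lintegral_sub_left_eq_self G₁, lintegral_add_left hG₂m, lintegral_neg_eq_self]
    _ ≤ ENNReal.ofReal K * ((C₁ * ENNReal.ofReal ((1 - r) ^ (-(A / 2)))) *
          (C₂ * ENNReal.ofReal ((1 - r) ^ (-(A / 2))) +
            C₂ * ENNReal.ofReal ((1 - r) ^ (-(A / 2))))) := by
        gcongr
        · exact h₁ _ hε
        · exact h₂ _ hε
        · exact h₂ _ hε
    _ = _ := by
        rw [show -A = -(A / 2) + -(A / 2) by ring, Real.rpow_add hε,
          ENNReal.ofReal_mul (p := (1 - r) ^ (-(A / 2))) (by positivity)]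
        ring

/-! ### The Forelli–Rudin estimate on the ball -/

section Geometry

variable {n : ℕ} {w z : Cn n}

theorem norm_herm_le (w z : Cn n) : ‖herm w z‖ ≤ ‖w‖ * ‖z‖ := by
  rw [mul_comm]; exact norm_inner_le_norm z w

theorem norm_one_sub_herm_comm (w z : Cn n) : ‖1 - herm w z‖ = ‖1 - herm z w‖ := by
  rw [← RCLike.norm_conj, map_sub, map_one]
  congr 2
  exact inner_conj_symm w z

theorem delta_comm (w z : Cn n) : delta w z = delta z w := by
  unfold delta
  rw [norm_one_sub_herm_comm]
  ring

theorem one_sub_le_norm_one_sub_herm (w z : Cn n) : 1 - ‖w‖ * ‖z‖ ≤ ‖1 - herm w z‖ := by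
  have h := norm_sub_norm_le 1 (herm w z)
  rw [norm_one] at h
  linarith [norm_herm_le w z]

theorem norm_one_sub_herm_le (w z : Cn n) : ‖1 - herm w z‖ ≤ 1 + ‖w‖ * ‖z‖ := by
  have h := norm_sub_le 1 (herm w z)
  rw [norm_one] at h
  linarith [norm_herm_le w z]

theorem norm_one_sub_herm_pos (hw : ‖w‖ ≤ 1) (hz : ‖z‖ < 1) : 0 < ‖1 - herm w z‖ := by
  refine lt_of_lt_of_le ?_ (one_sub_le_norm_one_sub_herm w z)
  nlinarith [norm_nonneg w, norm_nonneg z]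

theorem one_sub_norm_sq_le (hw : ‖w‖ ≤ 1) (hz : ‖z‖ < 1) : 1 - ‖z‖ ^ 2 ≤ 2 * ‖1 - herm w z‖ := by
  nlinarith [norm_nonneg w, norm_nonneg z, one_sub_le_norm_one_sub_herm w z]

theorem sq_norm_sub_norm_le_delta (hw : ‖w‖ ≤ 1) (hz : ‖z‖ ≤ 1) :
    (‖w‖ - ‖z‖) ^ 2 ≤ delta w z := by
  have h1 := one_sub_le_norm_one_sub_herm w z
  have h2 : 0 ≤ 1 - ‖w‖ * ‖z‖ := by nlinarith [norm_nonneg w, norm_nonneg z]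
  unfold delta
  nlinarith [pow_le_pow_left₀ h2 h1 2]

theorem delta_nonneg (hw : ‖w‖ ≤ 1) (hz : ‖z‖ ≤ 1) : 0 ≤ delta w z :=
  (sq_nonneg _).trans (sq_norm_sub_norm_le_delta hw hz)

theorem delta_le_sq (hw : ‖w‖ ≤ 1) (hz : ‖z‖ ≤ 1) : delta w z ≤ ‖1 - herm w z‖ ^ 2 := by
  unfold delta
  nlinarith [norm_nonneg w, norm_nonneg z,
    mul_nonneg (by nlinarith [norm_nonneg w] : 0 ≤ 1 - ‖w‖ ^ 2)
      (by nlinarith [norm_nonneg z] : 0 ≤ 1 - ‖z‖ ^ 2)]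

theorem delta_le_sq_norm_sub (w z : Cn n) : delta w z ≤ ‖w - z‖ ^ 2 := by
  have h1 : ‖1 - herm w z‖ ^ 2 = 1 - 2 * (herm w z).re + ‖herm w z‖ ^ 2 := by
    rw [Complex.sq_norm, Complex.sq_norm, Complex.normSq_apply, Complex.normSq_apply]
    simp
    ring
  have h2 : ‖w - z‖ ^ 2 = ‖w‖ ^ 2 - 2 * (herm w z).re + ‖z‖ ^ 2 := by
    rw [norm_sub_rev, norm_sub_sq (𝕜 := ℂ)]
    simp only [herm, RCLike.re_to_complex]
    ring
  have h3 := pow_le_pow_left₀ (norm_nonneg _) (norm_herm_le w z) 2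
  unfold delta
  rw [h1, h2]
  nlinarith

end Geometry

@[fun_prop]
theorem measurable_herm_left {n : ℕ} (z : Cn n) : Measurable fun w : Cn n => herm w z :=
  (by unfold herm; fun_prop : Continuous fun w : Cn n => herm w z).measurable

/-- For fixed `z`, the function `√Δ(·, z)` becomes `(1 - |z|²) |u|` under an affine real change of
variables of Jacobian `(1 - |z|²)^(n + 1)`: the component of `w - z` along `z` is scaled by
`1 - |z|²`, the orthogonal one by `√(1 - |z|²)`. -/
theorem lintegral_sqrt_delta {m : ℕ} {z : Cn (m + 1)} (hz : z ∈ unitBall (m + 1)) {H : ℝ → ℝ≥0∞}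
    (hH : Measurable H) :
    ∫⁻ w : Cn (m + 1), H √(delta w z) =
      ENNReal.ofReal ((1 - ‖z‖ ^ 2) ^ (m + 2)) *
        ∫⁻ u : Cn (m + 1), H ((1 - ‖z‖ ^ 2) * ‖u‖) := by
  obtain ⟨e, he, hze⟩ := exists_unit_smul z
  have hε := one_sub_norm_sq_pos hz
  set r := ‖z‖ with hr
  set ε := 1 - r ^ 2 with hεdef
  have h1 := lintegral_slice e he (fun q => H √(‖1 - (r : ℂ) * q.1‖ ^ 2 - (1 - q.2) * ε))
    (by fun_prop)
  have h2 := lintegral_slice e he (fun q => H (ε * √q.2)) (by fun_prop)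
  have h3 : ∀ (l : ℂ) (x : ℝ), ‖1 - (r : ℂ) * l‖ ^ 2 - (1 - (‖l‖ ^ 2 + x)) * ε =
      ‖l - r‖ ^ 2 + ε * x := fun l x => by
    rw [Complex.sq_norm, Complex.sq_norm, Complex.sq_norm, Complex.normSq_apply,
      Complex.normSq_apply, Complex.normSq_apply]
    simp
    rw [hεdef]
    ring
  have hsq : √ε ^ 2 = ε := Real.sq_sqrt hε.le
  calc ∫⁻ w : Cn (m + 1), H √(delta w z)
      = ∫⁻ l : ℂ, ∫⁻ v : Cn m, H √(‖l - r‖ ^ 2 + ε * ‖v‖ ^ 2) := by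
        simp_rw [h3] at h1
        rw [← h1]
        refine lintegral_congr fun w => ?_
        unfold delta
        rw [hze w]
    _ = ∫⁻ l : ℂ, ∫⁻ v : Cn m, H √(‖l‖ ^ 2 + ε * ‖v‖ ^ 2) :=
        lintegral_sub_right_eq_self (fun l : ℂ => ∫⁻ v : Cn m, H √(‖l‖ ^ 2 + ε * ‖v‖ ^ 2)) (r : ℂ)
    _ = ENNReal.ofReal (ε ^ 2) * ∫⁻ l : ℂ, ENNReal.ofReal (ε ^ m) *
          ∫⁻ v : Cn m, H (ε * √(‖l‖ ^ 2 + ‖v‖ ^ 2)) := by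
        rw [lintegral_eq_scaled volume hε, Complex.finrank_real_complex]
        congr 1
        refine lintegral_congr fun l => ?_
        rw [lintegral_eq_scaled volume (Real.sqrt_pos.2 hε), finrank_real_cn, pow_mul, hsq]
        congr 1
        refine lintegral_congr fun v => ?_
        congr 1
        rw [norm_smul, norm_smul, mul_pow, mul_pow, Real.norm_eq_abs, sq_abs, Real.norm_eq_abs,
          sq_abs, hsq, show ε ^ 2 * ‖l‖ ^ 2 + ε * (ε * ‖v‖ ^ 2) = ε ^ 2 * (‖l‖ ^ 2 + ‖v‖ ^ 2) by ring,
          Real.sqrt_mul (by positivity), Real.sqrt_sq hε.le]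
    _ = ENNReal.ofReal (ε ^ (m + 2)) * ∫⁻ u : Cn (m + 1), H (ε * ‖u‖) := by
        rw [lintegral_const_mul', ← mul_assoc, ← ENNReal.ofReal_mul (by positivity), ← pow_add,
          add_comm 2 m, ← h2]
        · simp only [Real.sqrt_sq (norm_nonneg _)]
        · exact ENNReal.ofReal_ne_top

theorem lintegral_norm_rpow_ne_top (m : ℕ) {c R : ℝ} (hc : -2 * ((m + 1 : ℕ) : ℝ) < c) :
    ∫⁻ u in Metric.ball (0 : Cn (m + 1)) R, ENNReal.ofReal (‖u‖ ^ c) ≠ ∞ := by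
  rw [lintegral_ne_top_iff_integrableOn (by fun_prop) (fun u _ => by positivity)
    Metric.isOpen_ball.measurableSet]
  refine integrableOn_ball_of_norm_le_rpow (C := 1) (α := -c)
    (by rw [finrank_real_cn]; omega) ?_ ?_
    (by fun_prop : Measurable fun u : Cn (m + 1) => ‖u‖ ^ c).aestronglyMeasurable
  · rw [finrank_real_cn]; push_cast at hc ⊢; linarith
  · refine .of_forall fun u => ?_
    rw [Real.norm_of_nonneg (by positivity), neg_neg, one_mul]

theorem lintegral_norm_rpow_eq_top (m : ℕ) {c R : ℝ} (hR : 0 < R)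
    (hc : c ≤ -2 * ((m + 1 : ℕ) : ℝ)) :
    ∫⁻ u in Metric.ball (0 : Cn (m + 1)) R, ENNReal.ofReal (‖u‖ ^ c) = ∞ := by
  by_contra h
  rw [← ne_eq, lintegral_ne_top_iff_integrableOn (by fun_prop) (fun u _ => by positivity)
    Metric.isOpen_ball.measurableSet,
    integrableOn_fun_norm_addHaar (volume : Measure (Cn (m + 1))) (f := fun y => y ^ c),
    finrank_real_cn] at h
  have h2 : IntegrableOn (fun y : ℝ => y ^ (((2 * (m + 1) - 1 : ℕ) : ℝ) + c)) (Set.Ioo 0 R) :=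
    h.congr_fun (fun y hy => by
      simp only [smul_eq_mul]
      rw [Real.rpow_add hy.1, Real.rpow_natCast]) measurableSet_Ioo
  rw [intervalIntegral.integrableOn_Ioo_rpow_iff hR, show 2 * (m + 1) - 1 = 2 * m + 1 by omega]
    at h2
  push_cast at hc h2
  linarith

/-- Away from the diagonal (in the sense `√Δ ≥ |1 - w z̄| / 2`) the factor
`(√Δ / |1 - w z̄|) ^ c` is bounded above and below. Near it, `|1 - w z̄|` and `1 - |w|²` are
comparable to `1 - |z|²`. -/
theorem forelliRudin_integrand_le {n : ℕ} {w z : Cn n} (N A B c : ℝ) (hw : w ∈ unitBall n)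
    (hz : z ∈ unitBall n) :
    (1 - ‖w‖ ^ 2) ^ B * √(delta w z) ^ c / ‖1 - herm w z‖ ^ (N + A + B + c) ≤
      2 ^ |c| * ((1 - ‖w‖ ^ 2) ^ B * ‖1 - herm w z‖ ^ (-(N + A + B))) +
        6 ^ |B| * 6 ^ |(-(N + A + B + c))| * (1 - ‖z‖ ^ 2) ^ (-(N + A + c)) *
          (Set.Iio (2 * (1 - ‖z‖ ^ 2))).indicator (fun x => x ^ c) √(delta w z) := by
  have hw1 := mem_unitBall.1 hw
  have hz1 := mem_unitBall.1 hz
  have hx := one_sub_norm_sq_pos hw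
  have hε := one_sub_norm_sq_pos hz
  have hD := norm_one_sub_herm_pos hw1.le hz1
  have hεD := one_sub_norm_sq_le hw1.le hz1
  have hxD : 1 - ‖w‖ ^ 2 ≤ 2 * ‖1 - herm w z‖ := by
    rw [norm_one_sub_herm_comm]; exact one_sub_norm_sq_le hz1.le hw1
  have hSD : √(delta w z) ≤ ‖1 - herm w z‖ :=
    Real.sqrt_le_iff.2 ⟨hD.le, delta_le_sq hw1.le hz1.le⟩
  have hS2 : √(delta w z) ^ 2 = delta w z := Real.sq_sqrt (delta_nonneg hw1.le hz1.le)
  have hdef : delta w z = ‖1 - herm w z‖ ^ 2 - (1 - ‖w‖ ^ 2) * (1 - ‖z‖ ^ 2) := rfl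
  have hS := Real.sqrt_nonneg (delta w z)
  set x := 1 - ‖w‖ ^ 2
  set ε := 1 - ‖z‖ ^ 2
  set D := ‖1 - herm w z‖
  set S := √(delta w z)
  rw [div_eq_mul_inv, ← Real.rpow_neg hD.le]
  rcases le_or_gt D (2 * S) with h | h
  · have hS0 : 0 < S := by linarith
    have h0 : 0 ≤ (Set.Iio (2 * ε)).indicator (fun x => x ^ c) S :=
      Set.indicator_apply_nonneg fun _ => by positivity
    refine le_add_of_le_of_nonneg ?_ (by positivity)
    calc x ^ B * S ^ c * D ^ (-(N + A + B + c))
        ≤ x ^ B * (2 ^ |c| * D ^ c) * D ^ (-(N + A + B + c)) := by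
          gcongr
          exact rpow_le_of_comparable c hS0 hD (by linarith) h
      _ = 2 ^ |c| * (x ^ B * (D ^ c * D ^ (-(N + A + B + c)))) := by ring
      _ = _ := by
          rw [← Real.rpow_add hD]
          congr 3
          ring
  · -- `√Δ < D / 2` says `x ε > (3/4) D²`, while `x` and `ε` are at most `2 D`.
    have hxε : 3 / 4 * D ^ 2 < x * ε := by nlinarith
    have hDε : D ≤ 8 / 3 * ε := by
      by_contra hcon
      push Not at hcon
      nlinarith
    have hDx : D ≤ 8 / 3 * x := by
      by_contra hcon
      push Not at hcon
      nlinarith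
    rw [Set.indicator_of_mem (show S ∈ Set.Iio (2 * ε) by simp only [Set.mem_Iio]; linarith)]
    refine le_add_of_nonneg_of_le (by positivity) ?_
    calc x ^ B * S ^ c * D ^ (-(N + A + B + c))
        ≤ (6 ^ |B| * ε ^ B) * S ^ c *
            (6 ^ |(-(N + A + B + c))| * ε ^ (-(N + A + B + c))) := by
          gcongr
          · exact rpow_le_of_comparable B hx hε (by linarith) (by linarith)
          · exact rpow_le_of_comparable _ hD hε (by linarith) (by linarith)
      _ = 6 ^ |B| * 6 ^ |(-(N + A + B + c))| * (ε ^ B * ε ^ (-(N + A + B + c))) * S ^ c := by ring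
      _ = _ := by
          rw [← Real.rpow_add hε]
          congr 3
          ring

/-- The classical Forelli–Rudin estimate, the case `c = 0`: integrating out the variables orthogonal
to `z` leaves the one on the disc with `B + m` in place of `B`. -/
theorem exists_classical_forelliRudin_le (m : ℕ) {A B : ℝ} (hA : 0 < A) (hB : -1 < B) :
    ∃ C : ℝ≥0∞, C ≠ ∞ ∧ ∀ z ∈ unitBall (m + 1),
      ∫⁻ w : Cn (m + 1), posPow B (1 - ‖w‖ ^ 2) *
        ENNReal.ofReal (‖1 - herm w z‖ ^ (-(((m + 1 : ℕ) : ℝ) + 1 + A + B))) ≤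
        C * ENNReal.ofReal ((1 - ‖z‖ ^ 2) ^ (-A)) := by
  obtain ⟨C, hC, h⟩ := exists_lintegral_disc_le (β := B + m) (A := A)
    (by linarith [(Nat.cast_nonneg m : (0 : ℝ) ≤ m)]) hA
  refine ⟨C * ENNReal.ofReal (2 ^ A) * ∫⁻ v : Cn m, posPow B (1 - ‖v‖ ^ 2), ?_, fun z hz => ?_⟩
  · exact ENNReal.mul_ne_top (by finiteness) (lintegral_weight_ne_top m hB)
  obtain ⟨e, he, hze⟩ := exists_unit_smul z
  have hz1 := mem_unitBall.1 hz
  have hs := lintegral_slice e he (fun q => posPow B (1 - q.2) *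
    ENNReal.ofReal (‖1 - (‖z‖ : ℂ) * q.1‖ ^ (-(((m + 1 : ℕ) : ℝ) + 1 + A + B)))) (by fun_prop)
  simp_rw [hze]
  rw [hs]
  have hin : ∀ l : ℂ, Measurable fun v : Cn m => posPow B (1 - (‖l‖ ^ 2 + ‖v‖ ^ 2)) :=
    fun l => by fun_prop
  simp_rw [lintegral_mul_const _ (hin _), lintegral_weight_slice]
  have h2 := h ‖z‖ (norm_nonneg z) hz1
  rw [show -(((m + 1 : ℕ) : ℝ) + 1 + A + B) = -(2 + A + (B + m)) by push_cast; ring]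
  calc _ = (∫⁻ l : ℂ, posPow (B + m) (1 - ‖l‖ ^ 2) *
        ENNReal.ofReal (‖1 - (‖z‖ : ℂ) * l‖ ^ (-(2 + A + (B + m))))) *
          ∫⁻ v : Cn m, posPow B (1 - ‖v‖ ^ 2) := by
        rw [← lintegral_mul_const _ (by fun_prop)]
        refine lintegral_congr fun l => ?_
        ring
    _ ≤ (C * (ENNReal.ofReal (2 ^ A) * ENNReal.ofReal ((1 - ‖z‖ ^ 2) ^ (-A)))) *
          ∫⁻ v : Cn m, posPow B (1 - ‖v‖ ^ 2) := by
        refine mul_le_mul_left (h2.trans ?_) _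
        gcongr
        rw [← ENNReal.ofReal_mul (by positivity)]
        refine ENNReal.ofReal_le_ofReal ?_
        have h3 := rpow_le_of_comparable (k := 2) (-A) (by linarith : 0 < 1 - ‖z‖)
          (one_sub_norm_sq_pos hz) (by nlinarith [norm_nonneg z]) (by nlinarith [norm_nonneg z])
        rwa [abs_neg, abs_of_pos hA] at h3
    _ = _ := by ring

/-- The Forelli–Rudin estimate with the extra factor `(√Δ(w, z) / |1 - w z̄|) ^ c`. -/
theorem exists_forelliRudin_le (m : ℕ) {A B c : ℝ} (hA : 0 < A) (hB : -1 < B)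
    (hc : -2 * ((m + 1 : ℕ) : ℝ) < c) :
    ∃ C : ℝ≥0∞, C ≠ ∞ ∧ ∀ z ∈ unitBall (m + 1),
      ∫⁻ w in unitBall (m + 1), ENNReal.ofReal ((1 - ‖w‖ ^ 2) ^ B * √(delta w z) ^ c /
        ‖1 - herm w z‖ ^ (((m + 1 : ℕ) : ℝ) + 1 + A + B + c)) ≤
        C * ENNReal.ofReal ((1 - ‖z‖ ^ 2) ^ (-A)) := by
  obtain ⟨C₁, hC₁, h₁⟩ := exists_classical_forelliRudin_le m hA hB
  set N : ℝ := ((m + 1 : ℕ) : ℝ) + 1 with hN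
  set K : ℝ := 6 ^ |B| * 6 ^ |(-(N + A + B + c))| with hK
  have hK0 : 0 ≤ K := by positivity
  set J := ∫⁻ u in Metric.ball (0 : Cn (m + 1)) 2, ENNReal.ofReal (‖u‖ ^ c) with hJ
  refine ⟨ENNReal.ofReal (2 ^ |c|) * C₁ + ENNReal.ofReal K * J, ?_, fun z hz => ?_⟩
  · exact ENNReal.add_ne_top.2 ⟨by finiteness,
      ENNReal.mul_ne_top ENNReal.ofReal_ne_top (lintegral_norm_rpow_ne_top m hc)⟩
  have hε := one_sub_norm_sq_pos hz
  set ε := 1 - ‖z‖ ^ 2 with hεd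
  set H : ℝ → ℝ≥0∞ := (Set.Iio (2 * ε)).indicator fun x => ENNReal.ofReal (x ^ c) with hH
  have hHm : Measurable H :=
    (by fun_prop : Measurable fun x : ℝ => ENNReal.ofReal (x ^ c)).indicator measurableSet_Iio
  have hnear : ∫⁻ w : Cn (m + 1), H √(delta w z) = ENNReal.ofReal (ε ^ (N + c)) * J := by
    rw [lintegral_sqrt_delta hz hHm, hJ, ← lintegral_indicator Metric.isOpen_ball.measurableSet]
    have h : ∀ u : Cn (m + 1), H (ε * ‖u‖) = ENNReal.ofReal (ε ^ c) *
        (Metric.ball (0 : Cn (m + 1)) 2).indicator (fun u => ENNReal.ofReal (‖u‖ ^ c)) u := by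
      intro u
      by_cases hu : ‖u‖ < 2
      · rw [Set.indicator_of_mem (by simpa using hu), hH,
          Set.indicator_of_mem (by simp only [Set.mem_Iio]; nlinarith),
          Real.mul_rpow hε.le (norm_nonneg _), ENNReal.ofReal_mul (by positivity)]
      · rw [Set.indicator_of_notMem (by simpa using hu), hH,
          Set.indicator_of_notMem (by simp only [Set.mem_Iio]; nlinarith), mul_zero]
    simp only [← hεd, h]
    rw [lintegral_const_mul' _ _ ENNReal.ofReal_ne_top, ← mul_assoc,
      ← ENNReal.ofReal_mul (by positivity), Real.rpow_add hε, ← Real.rpow_natCast]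
    congr 4
    rw [hN]
    push_cast
    ring
  calc ∫⁻ w in unitBall (m + 1), ENNReal.ofReal ((1 - ‖w‖ ^ 2) ^ B * √(delta w z) ^ c /
        ‖1 - herm w z‖ ^ (N + A + B + c))
      ≤ ∫⁻ w in unitBall (m + 1), (ENNReal.ofReal (2 ^ |c|) *
          (posPow B (1 - ‖w‖ ^ 2) * ENNReal.ofReal (‖1 - herm w z‖ ^ (-(N + A + B)))) +
          ENNReal.ofReal (K * ε ^ (-(N + A + c))) * H √(delta w z)) := by
        refine setLIntegral_mono' (measurableSet_unitBall _) fun w hw => ?_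
        have hx := one_sub_norm_sq_pos hw
        refine (ENNReal.ofReal_le_ofReal (forelliRudin_integrand_le N A B c hw hz)).trans ?_
        have hi : 0 ≤ (Set.Iio (2 * ε)).indicator (fun x => x ^ c) √(delta w z) :=
          Set.indicator_apply_nonneg fun _ => by positivity
        rw [ENNReal.ofReal_add (by positivity) (by positivity),
          ENNReal.ofReal_mul (by positivity), ENNReal.ofReal_mul (p := (1 - ‖w‖ ^ 2) ^ B)
            (by positivity), posPow_of_pos hx, ENNReal.ofReal_mul (p := _ * _) (by positivity)]
        refine le_of_eq ?_
        congr 2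
        by_cases hm : √(delta w z) ∈ Set.Iio (2 * ε)
        · rw [Set.indicator_of_mem hm, hH, Set.indicator_of_mem hm]
        · rw [Set.indicator_of_notMem hm, hH, Set.indicator_of_notMem hm, ENNReal.ofReal_zero]
    _ ≤ ∫⁻ w, (ENNReal.ofReal (2 ^ |c|) *
          (posPow B (1 - ‖w‖ ^ 2) * ENNReal.ofReal (‖1 - herm w z‖ ^ (-(N + A + B)))) +
          ENNReal.ofReal (K * ε ^ (-(N + A + c))) * H √(delta w z)) :=
        setLIntegral_le_lintegral _ _
    _ = ENNReal.ofReal (2 ^ |c|) * (∫⁻ w, posPow B (1 - ‖w‖ ^ 2) *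
            ENNReal.ofReal (‖1 - herm w z‖ ^ (-(N + A + B)))) +
          ENNReal.ofReal (K * ε ^ (-(N + A + c))) * (ENNReal.ofReal (ε ^ (N + c)) * J) := by
        rw [lintegral_add_left (by fun_prop), lintegral_const_mul' _ _ ENNReal.ofReal_ne_top,
          lintegral_const_mul' _ _ ENNReal.ofReal_ne_top, hnear]
    _ ≤ ENNReal.ofReal (2 ^ |c|) * (C₁ * ENNReal.ofReal (ε ^ (-A))) +
          ENNReal.ofReal (K * ε ^ (-(N + A + c))) * (ENNReal.ofReal (ε ^ (N + c)) * J) := by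
        gcongr
        exact h₁ z hz
    _ = _ := by
        rw [show -A = -(N + A + c) + (N + c) by ring, Real.rpow_add hε,
          ENNReal.ofReal_mul (p := K) hK0, ENNReal.ofReal_mul (p := ε ^ (-(N + A + c)))
            (by positivity)]
        ring

/-! ### Reduction to nonnegative functions -/

/-- The operator `T_{a,b,c}` on nonnegative functions, as a Lebesgue integral with values in
`[0, ∞]`. -/
noncomputable def posT (n : ℕ) (a b c : ℝ) (g : Cn n → ℝ≥0∞) (z : Cn n) : ℝ≥0∞ :=
  ∫⁻ w in unitBall n, ENNReal.ofReal (kernel n a b c z w) * g w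

instance sigmaFinite_ballVolume (n : ℕ) : SigmaFinite (ballVolume n) := by
  unfold ballVolume
  infer_instance

/-- The inequality `‖T g‖ ^ p ≤ C ‖g‖ ^ p` in the weighted `Lᵖ` space, for all finite nonnegative
measurable `g`. -/
def IsPosBoundedOnLp (n : ℕ) (a b c t p : ℝ) (C : ℝ≥0) : Prop :=
  ∀ g : Cn n → ℝ≥0, Measurable g →
    ∫⁻ z, posT n a b c (fun w => g w) z ^ p ∂(weightedVolume n t) ≤
      C * ∫⁻ z, (g z : ℝ≥0∞) ^ p ∂(weightedVolume n t)

section Basic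

variable {n : ℕ} {a b c t p : ℝ}

theorem kernel_nonneg {z w : Cn n} (hz : z ∈ unitBall n) (hw : w ∈ unitBall n) :
    0 ≤ kernel n a b c z w := by
  have h1 := one_sub_norm_sq_pos hz
  have h2 := one_sub_norm_sq_pos hw
  unfold kernel
  positivity

theorem measurable_kernel : Measurable fun q : Cn n × Cn n => kernel n a b c q.1 q.2 := by
  have h : Measurable fun q : Cn n × Cn n => herm q.2 q.1 :=
    (by unfold herm; fun_prop : Continuous fun q : Cn n × Cn n => herm q.2 q.1).measurable
  unfold kernel delta
  fun_prop

theorem measurable_kernel_right (z : Cn n) : Measurable fun w : Cn n => kernel n a b c z w := by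
  unfold kernel delta
  fun_prop

theorem measurable_posT {g : Cn n → ℝ≥0∞} (hg : Measurable g) : Measurable (posT n a b c g) :=
  Measurable.lintegral_prod_right' (f := fun q : Cn n × Cn n =>
    ENNReal.ofReal (kernel n a b c q.1 q.2) * g q.2)
    (measurable_kernel.ennreal_ofReal.mul (hg.comp measurable_snd))

theorem lintegral_weightedVolume (t : ℝ) (F : Cn n → ℝ≥0∞) :
    ∫⁻ z, F z ∂(weightedVolume n t) =
      ∫⁻ z in unitBall n, ENNReal.ofReal ((1 - ‖z‖ ^ 2) ^ t) * F z :=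
  lintegral_withDensity_eq_lintegral_mul_non_measurable _ (by fun_prop)
    (.of_forall fun _ => ENNReal.ofReal_lt_top) F

theorem ballVolume_absolutelyContinuous (t : ℝ) : ballVolume n ≪ weightedVolume n t := by
  refine withDensity_absolutelyContinuous'
    (by fun_prop : Measurable fun w : Cn n => ENNReal.ofReal ((1 - ‖w‖ ^ 2) ^ t)).aemeasurable ?_
  filter_upwards [ae_restrict_mem (measurableSet_unitBall n)] with w hw
  have := one_sub_norm_sq_pos hw
  exact (ENNReal.ofReal_pos.2 (by positivity)).ne'

theorem weightedVolume_absolutelyContinuous (t : ℝ) : weightedVolume n t ≪ ballVolume n :=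
  withDensity_absolutelyContinuous _ _

theorem eLpNorm_weightedVolume (hp : 1 ≤ p) (f : Cn n → ℂ) :
    eLpNorm f (ENNReal.ofReal p) (weightedVolume n t) =
      (∫⁻ z, ‖f z‖ₑ ^ p ∂(weightedVolume n t)) ^ (1 / p) := by
  rw [eLpNorm_eq_lintegral_rpow_enorm_toReal (by simpa using by linarith) ENNReal.ofReal_ne_top,
    ENNReal.toReal_ofReal (by linarith)]

theorem lintegral_enorm_kernel_mul {z : Cn n} (hz : z ∈ unitBall n) (f : Cn n → ℂ) :
    ∫⁻ w, ‖(kernel n a b c z w : ℂ) * f w‖ₑ ∂(ballVolume n) =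
      posT n a b c (fun w => ‖f w‖ₑ) z := by
  refine setLIntegral_congr_fun (measurableSet_unitBall n) fun w hw => ?_
  simp only
  rw [enorm_mul, ← Real.enorm_of_nonneg (kernel_nonneg hz hw)]
  congr 1
  simp [enorm_eq_nnnorm]

end Basic

/-- Boundedness of `T_{a,b,c}` is a statement about nonnegative functions only: its kernel is
nonnegative. -/
theorem isBoundedOnLp_iff {n : ℕ} {a b c t p : ℝ} (hp : 1 ≤ p) :
    IsBoundedOnLp n a b c t p ↔ ∃ C : ℝ≥0, IsPosBoundedOnLp n a b c t p C := by
  have hp0 : 0 < p := by linarith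
  constructor
  · rintro ⟨C, hC⟩
    -- The summand `1` keeps the constant positive, so that the bound is trivial if `‖g‖ = ∞`.
    refine ⟨C ^ p + 1, fun g hg => ?_⟩
    by_cases hfin : ∫⁻ z, (g z : ℝ≥0∞) ^ p ∂(weightedVolume n t) = ∞
    · rw [hfin, ENNReal.mul_top (by positivity)]
      exact le_top
    set f : Cn n → ℂ := fun w => ((g w : ℝ) : ℂ) with hf
    have hfe : ∀ w, ‖f w‖ₑ = g w := fun w => by simp [hf, enorm_eq_nnnorm]
    have hfm : Measurable f := by fun_prop
    have hnorm := eLpNorm_weightedVolume (n := n) (t := t) hp f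
    simp_rw [hfe] at hnorm
    have hmem : MemLp f (ENNReal.ofReal p) (weightedVolume n t) :=
      ⟨hfm.aestronglyMeasurable, by
        rw [hnorm]; exact ENNReal.rpow_lt_top_of_nonneg (by positivity) hfin⟩
    obtain ⟨h1, -, h3⟩ := hC f hmem
    rw [eLpNorm_weightedVolume hp, hnorm] at h3
    have h4 : ∀ᵐ z ∂(weightedVolume n t), posT n a b c (fun w => g w) z = ‖opT n a b c f z‖ₑ := by
      refine (weightedVolume_absolutelyContinuous t).ae_le ?_
      filter_upwards [h1, ae_restrict_mem (measurableSet_unitBall n)] with z hzi hz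
      have h5 : opT n a b c f z =
          ((∫ w, kernel n a b c z w * (g w : ℝ) ∂(ballVolume n) : ℝ) : ℂ) := by
        rw [← integral_complex_ofReal]
        unfold opT
        simp [hf]
      have hre : Integrable (fun w => kernel n a b c z w * (g w : ℝ)) (ballVolume n) := by
        have := hzi.re
        simpa [hf] using this
      have hnn : 0 ≤ᵐ[ballVolume n] fun w => kernel n a b c z w * (g w : ℝ) := by
        filter_upwards [ae_restrict_mem (measurableSet_unitBall n)] with w hw
        exact mul_nonneg (kernel_nonneg hz hw) (g w).2
      have h6 : ‖((∫ w, kernel n a b c z w * (g w : ℝ) ∂(ballVolume n) : ℝ) : ℂ)‖ₑ =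
          ENNReal.ofReal (∫ w, kernel n a b c z w * (g w : ℝ) ∂(ballVolume n)) := by
        rw [← Real.enorm_of_nonneg (integral_nonneg_of_ae hnn)]
        simp [enorm_eq_nnnorm]
      rw [h5, h6, ofReal_integral_eq_lintegral_ofReal hre hnn]
      refine setLIntegral_congr_fun (measurableSet_unitBall n) fun w hw => ?_
      simp only
      rw [ENNReal.ofReal_mul (kernel_nonneg hz hw), ENNReal.ofReal_coe_nnreal]
    have h7 : ∫⁻ z, posT n a b c (fun w => g w) z ^ p ∂(weightedVolume n t) =
        ∫⁻ z, ‖opT n a b c f z‖ₑ ^ p ∂(weightedVolume n t) := by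
      refine lintegral_congr_ae ?_
      filter_upwards [h4] with z hz
      rw [hz]
    rw [h7]
    have h8 := ENNReal.rpow_le_rpow h3 hp0.le
    rw [ENNReal.mul_rpow_of_nonneg _ _ hp0.le, ← ENNReal.rpow_mul, ← ENNReal.rpow_mul,
      one_div_mul_cancel hp0.ne', ENNReal.rpow_one, ENNReal.rpow_one] at h8
    refine h8.trans ?_
    gcongr
    rw [ENNReal.coe_add, ENNReal.coe_rpow_of_nonneg _ hp0.le]
    exact le_self_add
  · rintro ⟨C, hC⟩
    refine ⟨C ^ (1 / p), fun f hf => ?_⟩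
    set f' : Cn n → ℂ := hf.1.mk f with hf'
    have hf'm : StronglyMeasurable f' := hf.1.stronglyMeasurable_mk
    have hae : f =ᵐ[weightedVolume n t] f' := hf.1.ae_eq_mk
    have haeV : f =ᵐ[ballVolume n] f' := (ballVolume_absolutelyContinuous t).ae_le hae
    have hg := hC (fun w => ‖f' w‖₊) hf'm.measurable.nnnorm
    simp only [← enorm_eq_nnnorm] at hg
    have hfin : ∫⁻ z, ‖f' z‖ₑ ^ p ∂(weightedVolume n t) ≠ ∞ := by
      have h1 := hf.2
      rw [eLpNorm_congr_ae hae, eLpNorm_weightedVolume hp] at h1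
      intro h2
      rw [h2, ENNReal.top_rpow_of_pos (by positivity)] at h1
      exact lt_irrefl _ h1
    have hTm : Measurable (posT n a b c fun w => ‖f' w‖ₑ) :=
      measurable_posT hf'm.measurable.enorm
    have hTfin : ∀ᵐ z ∂(ballVolume n), posT n a b c (fun w => ‖f' w‖ₑ) z ≠ ∞ := by
      refine (ballVolume_absolutelyContinuous t).ae_le ?_
      have h1 := ae_lt_top (hTm.pow_const p)
        (ne_top_of_le_ne_top (ENNReal.mul_ne_top ENNReal.coe_ne_top hfin) hg)
      filter_upwards [h1] with z hz h2
      rw [h2, ENNReal.top_rpow_of_pos hp0] at hz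
      exact lt_irrefl _ hz
    have hop : opT n a b c f = opT n a b c f' := by
      funext z
      refine integral_congr_ae ?_
      filter_upwards [haeV] with w hw
      rw [hw]
    have hopm : StronglyMeasurable (opT n a b c f') := by
      refine StronglyMeasurable.integral_prod_right (f := fun z w =>
        (kernel n a b c z w : ℂ) * f' w) ?_
      refine StronglyMeasurable.mul ?_ (hf'm.comp_measurable measurable_snd)
      exact (Complex.measurable_ofReal.comp measurable_kernel).stronglyMeasurable
    have hle : ∀ᵐ z ∂(weightedVolume n t),
        ‖opT n a b c f' z‖ₑ ≤ posT n a b c (fun w => ‖f' w‖ₑ) z := by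
      refine (weightedVolume_absolutelyContinuous t).ae_le ?_
      filter_upwards [ae_restrict_mem (measurableSet_unitBall n)] with z hz
      rw [← lintegral_enorm_kernel_mul hz]
      exact enorm_integral_le_lintegral_enorm _
    have hnorm : eLpNorm (opT n a b c f) (ENNReal.ofReal p) (weightedVolume n t) ≤
        (C ^ (1 / p) : ℝ≥0) * eLpNorm f (ENNReal.ofReal p) (weightedVolume n t) := by
      rw [hop, eLpNorm_congr_ae hae, eLpNorm_weightedVolume hp, eLpNorm_weightedVolume hp,
        ENNReal.coe_rpow_of_nonneg _ (by positivity), ← ENNReal.mul_rpow_of_nonneg _ _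
        (by positivity)]
      refine ENNReal.rpow_le_rpow ((lintegral_mono_ae ?_).trans hg) (by positivity)
      filter_upwards [hle] with z hz
      exact ENNReal.rpow_le_rpow hz hp0.le
    refine ⟨?_, ⟨hop ▸ hopm.aestronglyMeasurable, hnorm.trans_lt
      (ENNReal.mul_lt_top ENNReal.coe_lt_top hf.2)⟩, hnorm⟩
    filter_upwards [hTfin, ae_restrict_mem (measurableSet_unitBall n)] with z hzfin hz
    have h1 : Integrable (fun w => (kernel n a b c z w : ℂ) * f' w) (ballVolume n) := by
      refine ⟨?_, ?_⟩
      · exact ((Complex.measurable_ofReal.comp (measurable_kernel_right z)).mul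
          hf'm.measurable).aestronglyMeasurable
      · rw [hasFiniteIntegral_iff_enorm, lintegral_enorm_kernel_mul hz]
        exact hzfin.lt_top
    refine h1.congr ?_
    filter_upwards [haeV] with w hw
    rw [hw]

/-! ### Sufficiency: Schur's test -/

theorem kernel_comm {n : ℕ} (a b c : ℝ) (z w : Cn n) :
    kernel n a b c z w = kernel n b a c w z := by
  unfold kernel
  rw [delta_comm, norm_one_sub_herm_comm, mul_comm ((1 - ‖z‖ ^ 2) ^ a),
    show (n : ℝ) + 1 + a + b + c = (n : ℝ) + 1 + b + a + c by ring]

/-- Powers of `1 - |w|²` in a suitable range are, up to a constant, supersolutions for `T_{a,b,c}`: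
they serve as the test functions in Schur's test. -/
theorem exists_posT_rpow_le (m : ℕ) {a b c τ : ℝ} (hc : -2 * ((m + 1 : ℕ) : ℝ) < c) (ha : τ < a)
    (hb : -1 < b + τ) :
    ∃ C : ℝ≥0∞, C ≠ ∞ ∧ ∀ z ∈ unitBall (m + 1),
      posT (m + 1) a b c (fun w => ENNReal.ofReal ((1 - ‖w‖ ^ 2) ^ τ)) z ≤
        C * ENNReal.ofReal ((1 - ‖z‖ ^ 2) ^ τ) := by
  obtain ⟨C, hC, h⟩ := exists_forelliRudin_le m (sub_pos.2 ha) hb hc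
  refine ⟨C, hC, fun z hz => ?_⟩
  have hε := one_sub_norm_sq_pos hz
  calc posT (m + 1) a b c (fun w => ENNReal.ofReal ((1 - ‖w‖ ^ 2) ^ τ)) z
      = ∫⁻ w in unitBall (m + 1), ENNReal.ofReal ((1 - ‖z‖ ^ 2) ^ a) *
          ENNReal.ofReal ((1 - ‖w‖ ^ 2) ^ (b + τ) * √(delta w z) ^ c /
            ‖1 - herm w z‖ ^ (((m + 1 : ℕ) : ℝ) + 1 + (a - τ) + (b + τ) + c)) := by
        refine setLIntegral_congr_fun (measurableSet_unitBall _) fun w hw => ?_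
        have hx := one_sub_norm_sq_pos hw
        simp only
        rw [← ENNReal.ofReal_mul (kernel_nonneg hz hw), ← ENNReal.ofReal_mul (by positivity),
          Real.rpow_add hx, show ((m + 1 : ℕ) : ℝ) + 1 + (a - τ) + (b + τ) + c =
            ((m + 1 : ℕ) : ℝ) + 1 + a + b + c by ring]
        unfold kernel
        congr 1
        ring
    _ ≤ ENNReal.ofReal ((1 - ‖z‖ ^ 2) ^ a) *
          (C * ENNReal.ofReal ((1 - ‖z‖ ^ 2) ^ (-(a - τ)))) := by
        rw [lintegral_const_mul' _ _ ENNReal.ofReal_ne_top]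
        gcongr
        exact h z hz
    _ = _ := by
        rw [show τ = a + -(a - τ) by ring, Real.rpow_add hε,
          ENNReal.ofReal_mul (by positivity)]
        ring_nf

/-- Hölder's inequality against the kernel, with the weight `(1 - |w|²) ^ (s / p)` inserted. For
`p = 1` only `s = 0` is needed, and nothing has to be proved. -/
theorem exists_posT_rpow_le_posT (m : ℕ) {a b c p s : ℝ} (hc : -2 * ((m + 1 : ℕ) : ℝ) < c)
    (hp : 1 ≤ p) (h1 : p = 1 → s = 0)
    (h2 : 1 < p → s < a * (p - 1) ∧ -((b + 1) * (p - 1)) < s) :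
    ∃ C : ℝ≥0∞, C ≠ ∞ ∧ ∀ g : Cn (m + 1) → ℝ≥0∞, Measurable g → ∀ z ∈ unitBall (m + 1),
      posT (m + 1) a b c g z ^ p ≤ C * ENNReal.ofReal ((1 - ‖z‖ ^ 2) ^ s) *
        posT (m + 1) a b c (fun w => g w ^ p * ENNReal.ofReal ((1 - ‖w‖ ^ 2) ^ (-s))) z := by
  rcases hp.eq_or_lt with rfl | hp1
  · refine ⟨1, ENNReal.one_ne_top, fun g hg z hz => ?_⟩
    simp [h1 rfl]
  obtain ⟨hs1, hs2⟩ := h2 hp1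
  have hp0 : 0 < p := by linarith
  have hpm : 0 < p - 1 := by linarith
  set q := p / (p - 1) with hq
  have hq0 : 0 < q := by positivity
  have hpq : q.HolderConjugate p := (Real.HolderConjugate.conjExponent hp1).symm
  obtain ⟨C, hC, hT⟩ := exists_posT_rpow_le m (a := a) (b := b) (c := c) (τ := s / (p - 1)) hc
    ((div_lt_iff₀ hpm).2 hs1) (by
      have : -(b + 1) < s / (p - 1) := (lt_div_iff₀ hpm).2 (by linarith)
      linarith)
  refine ⟨C ^ (p - 1), ENNReal.rpow_ne_top_of_nonneg hpm.le hC, fun g hg z hz => ?_⟩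
  have hε := one_sub_norm_sq_pos hz
  have hK : Measurable fun w => ENNReal.ofReal (kernel (m + 1) a b c z w) :=
    (measurable_kernel_right z).ennreal_ofReal
  set F : Cn (m + 1) → ℝ≥0∞ := fun w => ENNReal.ofReal (kernel (m + 1) a b c z w) ^ (1 / q) *
    ENNReal.ofReal ((1 - ‖w‖ ^ 2) ^ (s / p)) with hF
  set G : Cn (m + 1) → ℝ≥0∞ := fun w => ENNReal.ofReal (kernel (m + 1) a b c z w) ^ (1 / p) *
    (g w * ENNReal.ofReal ((1 - ‖w‖ ^ 2) ^ (-(s / p)))) with hG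
  have hFG : posT (m + 1) a b c g z = ∫⁻ w in unitBall (m + 1), (F * G) w := by
    refine setLIntegral_congr_fun (measurableSet_unitBall _) fun w hw => ?_
    have hx := one_sub_norm_sq_pos hw
    have e1 : ENNReal.ofReal ((1 - ‖w‖ ^ 2) ^ (s / p)) *
        ENNReal.ofReal ((1 - ‖w‖ ^ 2) ^ (-(s / p))) = 1 := by
      rw [← ENNReal.ofReal_mul (by positivity), ← Real.rpow_add hx, add_neg_cancel,
        Real.rpow_zero, ENNReal.ofReal_one]
    have e2 : ENNReal.ofReal (kernel (m + 1) a b c z w) ^ (1 / q) *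
        ENNReal.ofReal (kernel (m + 1) a b c z w) ^ (1 / p) =
          ENNReal.ofReal (kernel (m + 1) a b c z w) := by
      rw [← ENNReal.rpow_add_of_nonneg _ _ (by positivity) (by positivity), one_div, one_div,
        hpq.inv_add_inv_eq_one, ENNReal.rpow_one]
    simp only [hF, hG, Pi.mul_apply]
    calc ENNReal.ofReal (kernel (m + 1) a b c z w) * g w
        = (ENNReal.ofReal (kernel (m + 1) a b c z w) ^ (1 / q) *
            ENNReal.ofReal (kernel (m + 1) a b c z w) ^ (1 / p)) * g w *
          (ENNReal.ofReal ((1 - ‖w‖ ^ 2) ^ (s / p)) *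
            ENNReal.ofReal ((1 - ‖w‖ ^ 2) ^ (-(s / p)))) := by rw [e1, e2, mul_one]
      _ = _ := by ring
  have hFq : ∫⁻ w in unitBall (m + 1), F w ^ q =
      posT (m + 1) a b c (fun w => ENNReal.ofReal ((1 - ‖w‖ ^ 2) ^ (s / (p - 1)))) z := by
    refine setLIntegral_congr_fun (measurableSet_unitBall _) fun w hw => ?_
    have hx := one_sub_norm_sq_pos hw
    have e1 : s / p * q = s / (p - 1) := by
      rw [hq]
      field_simp
    simp only [hF]
    rw [ENNReal.mul_rpow_of_nonneg _ _ hq0.le, ← ENNReal.rpow_mul, one_div_mul_cancel hq0.ne',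
      ENNReal.rpow_one, ENNReal.ofReal_rpow_of_pos (by positivity), ← Real.rpow_mul hx.le, e1]
  have hGp : ∫⁻ w in unitBall (m + 1), G w ^ p =
      posT (m + 1) a b c (fun w => g w ^ p * ENNReal.ofReal ((1 - ‖w‖ ^ 2) ^ (-s))) z := by
    refine setLIntegral_congr_fun (measurableSet_unitBall _) fun w hw => ?_
    have hx := one_sub_norm_sq_pos hw
    simp only [hG]
    rw [ENNReal.mul_rpow_of_nonneg _ _ hp0.le, ENNReal.mul_rpow_of_nonneg _ _ hp0.le,
      ← ENNReal.rpow_mul, one_div_mul_cancel hp0.ne',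
      ENNReal.rpow_one, ENNReal.ofReal_rpow_of_pos (by positivity), ← Real.rpow_mul hx.le]
    congr 5
    field_simp
  have hH := ENNReal.lintegral_mul_le_Lp_mul_Lq (ballVolume (m + 1)) hpq (f := F) (g := G)
    (by fun_prop) (by fun_prop)
  calc posT (m + 1) a b c g z ^ p
      ≤ ((C * ENNReal.ofReal ((1 - ‖z‖ ^ 2) ^ (s / (p - 1)))) ^ (1 / q) *
          (posT (m + 1) a b c (fun w => g w ^ p *
            ENNReal.ofReal ((1 - ‖w‖ ^ 2) ^ (-s))) z) ^ (1 / p)) ^ p := by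
        refine ENNReal.rpow_le_rpow ?_ hp0.le
        rw [hFG]
        refine hH.trans ?_
        unfold ballVolume
        rw [hFq, hGp]
        gcongr
        exact hT z hz
    _ = _ := by
        have e1 : 1 / q * p = p - 1 := by rw [hq]; field_simp
        rw [ENNReal.mul_rpow_of_nonneg _ _ hp0.le, ← ENNReal.rpow_mul, ← ENNReal.rpow_mul,
          one_div_mul_cancel hp0.ne', ENNReal.rpow_one, e1,
          ENNReal.mul_rpow_of_nonneg _ _ hpm.le, ENNReal.ofReal_rpow_of_pos (by positivity),
          ← Real.rpow_mul hε.le, div_mul_cancel₀ _ hpm.ne']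

/-- Schur's test, combining Hölder's inequality and Tonelli's theorem. -/
theorem isBoundedOnLp_of_exponent (m : ℕ) {a b c t p s : ℝ} (hc : -2 * ((m + 1 : ℕ) : ℝ) < c)
    (hp : 1 ≤ p) (h1 : p = 1 → s = 0)
    (h2 : 1 < p → s < a * (p - 1) ∧ -((b + 1) * (p - 1)) < s)
    (h3 : -(a + t + 1) < s) (h4 : s < b - t) : IsBoundedOnLp (m + 1) a b c t p := by
  rw [isBoundedOnLp_iff hp]
  obtain ⟨C₁, hC₁, hT₁⟩ := exists_posT_rpow_le_posT m hc hp h1 h2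
  obtain ⟨C₂, hC₂, hT₂⟩ := exists_posT_rpow_le m (a := b) (b := a) (c := c) (τ := t + s) hc
    (by linarith) (by linarith)
  refine ⟨(C₁ * C₂).toNNReal, fun g hg => ?_⟩
  rw [ENNReal.coe_toNNReal (ENNReal.mul_ne_top hC₁ hC₂), lintegral_weightedVolume,
    lintegral_weightedVolume]
  set G : Cn (m + 1) → ℝ≥0∞ := fun w => (g w : ℝ≥0∞) ^ p * ENNReal.ofReal ((1 - ‖w‖ ^ 2) ^ (-s))
    with hG
  have hGm : Measurable G := by fun_prop
  have hKm : Measurable fun q : Cn (m + 1) × Cn (m + 1) =>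
      ENNReal.ofReal (kernel (m + 1) a b c q.1 q.2) := measurable_kernel.ennreal_ofReal
  calc ∫⁻ z in unitBall (m + 1), ENNReal.ofReal ((1 - ‖z‖ ^ 2) ^ t) *
        posT (m + 1) a b c (fun w => g w) z ^ p
      ≤ ∫⁻ z in unitBall (m + 1), C₁ * ∫⁻ w in unitBall (m + 1),
          ENNReal.ofReal ((1 - ‖z‖ ^ 2) ^ (t + s)) *
            (ENNReal.ofReal (kernel (m + 1) a b c z w) * G w) := by
        refine setLIntegral_mono' (measurableSet_unitBall _) fun z hz => ?_
        have hε := one_sub_norm_sq_pos hz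
        rw [lintegral_const_mul' _ _ ENNReal.ofReal_ne_top, Real.rpow_add hε,
          ENNReal.ofReal_mul (by positivity)]
        calc _ ≤ ENNReal.ofReal ((1 - ‖z‖ ^ 2) ^ t) * (C₁ * ENNReal.ofReal ((1 - ‖z‖ ^ 2) ^ s) *
                posT (m + 1) a b c G z) := by
              gcongr
              exact hT₁ _ (by fun_prop) z hz
          _ = C₁ * (ENNReal.ofReal ((1 - ‖z‖ ^ 2) ^ t) * ENNReal.ofReal ((1 - ‖z‖ ^ 2) ^ s) *
                posT (m + 1) a b c G z) := by ring
          _ = _ := rfl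
    _ = C₁ * ∫⁻ w in unitBall (m + 1), ∫⁻ z in unitBall (m + 1),
          ENNReal.ofReal ((1 - ‖z‖ ^ 2) ^ (t + s)) *
            (ENNReal.ofReal (kernel (m + 1) a b c z w) * G w) := by
        rw [lintegral_const_mul' _ _ hC₁, lintegral_lintegral_swap]
        refine Measurable.aemeasurable ?_
        exact Measurable.mul (by fun_prop) (hKm.mul (hGm.comp measurable_snd))
    _ = C₁ * ∫⁻ w in unitBall (m + 1), G w *
          posT (m + 1) b a c (fun z => ENNReal.ofReal ((1 - ‖z‖ ^ 2) ^ (t + s))) w := by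
        congr 1
        refine lintegral_congr fun w => ?_
        unfold posT
        have hm : Measurable fun z : Cn (m + 1) => ENNReal.ofReal (kernel (m + 1) b a c w z) *
            ENNReal.ofReal ((1 - ‖z‖ ^ 2) ^ (t + s)) :=
          (measurable_kernel_right w).ennreal_ofReal.mul (by fun_prop)
        rw [← lintegral_const_mul _ hm]
        refine lintegral_congr fun z => ?_
        rw [kernel_comm a b c z w]
        ring
    _ ≤ C₁ * ∫⁻ w in unitBall (m + 1), C₂ *
          (ENNReal.ofReal ((1 - ‖w‖ ^ 2) ^ t) * (g w : ℝ≥0∞) ^ p) := by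
        gcongr C₁ * ?_
        refine setLIntegral_mono' (measurableSet_unitBall _) fun w hw => ?_
        have hx := one_sub_norm_sq_pos hw
        have e1 : ENNReal.ofReal ((1 - ‖w‖ ^ 2) ^ (-s)) *
            ENNReal.ofReal ((1 - ‖w‖ ^ 2) ^ (t + s)) = ENNReal.ofReal ((1 - ‖w‖ ^ 2) ^ t) := by
          rw [← ENNReal.ofReal_mul (by positivity), ← Real.rpow_add hx]
          congr 2
          ring
        calc _ ≤ G w * (C₂ * ENNReal.ofReal ((1 - ‖w‖ ^ 2) ^ (t + s))) := by
              gcongr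
              exact hT₂ w hw
          _ = C₂ * ((ENNReal.ofReal ((1 - ‖w‖ ^ 2) ^ (-s)) *
                ENNReal.ofReal ((1 - ‖w‖ ^ 2) ^ (t + s))) * (g w : ℝ≥0∞) ^ p) := by
              rw [hG]; ring
          _ = _ := by rw [e1]
    _ = _ := by
        rw [lintegral_const_mul' _ _ hC₂]
        ring

theorem isBoundedOnLp_of_conditions (m : ℕ) {a b c t p : ℝ} (hp : 1 ≤ p)
    (hc : -2 * ((m + 1 : ℕ) : ℝ) < c) (ha : -(p * a) < t + 1) (hb : t + 1 < p * (b + 1)) :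
    IsBoundedOnLp (m + 1) a b c t p := by
  rcases hp.eq_or_lt with rfl | hp1
  · exact isBoundedOnLp_of_exponent m (s := 0) hc hp (fun _ => rfl) (fun h => absurd h (by simp))
      (by linarith) (by linarith)
  · have hpm : 0 < p - 1 := by linarith
    -- Two of the four inequalities needed for `s` to exist amount to this one.
    have hab : 0 < a + b + 1 := by
      by_contra h
      nlinarith
    obtain ⟨s, hs1, hs2⟩ : ∃ s, max (-((b + 1) * (p - 1))) (-(a + t + 1)) < s ∧
        s < min (a * (p - 1)) (b - t) := by
      refine exists_between ?_
      rw [max_lt_iff, lt_min_iff, lt_min_iff]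
      refine ⟨⟨?_, ?_⟩, ?_, ?_⟩ <;> nlinarith
    rw [max_lt_iff] at hs1
    rw [lt_min_iff] at hs2
    exact isBoundedOnLp_of_exponent m hc hp (fun h => absurd h hp1.ne')
      (fun _ => ⟨hs2.1, hs1.1⟩) hs1.2 hs2.2

/-! ### Necessity of the bounds on `c` and `a` -/

/-- The difference `|w|² |z|² - |w z̄|²` depends on `w` modulo `z` only. -/
theorem delta_eq {n : ℕ} (w z : Cn n) :
    delta w z = ‖w - z‖ ^ 2 * (1 - ‖z‖ ^ 2) + ‖herm (w - z) z‖ ^ 2 := by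
  have h1 : herm w z = herm (w - z) z + ((‖z‖ ^ 2 : ℝ) : ℂ) := by
    have h : inner ℂ z z = ((‖z‖ ^ 2 : ℝ) : ℂ) := by
      rw [inner_self_eq_norm_sq_to_K]; norm_cast
    simp only [herm, inner_sub_right]
    rw [h]
    ring
  have h2 : ‖w‖ ^ 2 = ‖w - z‖ ^ 2 + 2 * (herm (w - z) z).re + ‖z‖ ^ 2 := by
    have h := norm_add_sq (𝕜 := ℂ) z (w - z)
    rw [add_sub_cancel] at h
    rw [h]
    simp only [herm, RCLike.re_to_complex]
    ring
  unfold delta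
  rw [h1, h2]
  generalize herm (w - z) z = ζ
  rw [Complex.sq_norm, Complex.sq_norm, Complex.normSq_apply, Complex.normSq_apply]
  simp only [Complex.sub_re, Complex.sub_im, Complex.add_re, Complex.add_im, Complex.ofReal_re,
    Complex.ofReal_im, Complex.one_re, Complex.one_im]
  ring

theorem delta_pos {n : ℕ} {w z : Cn n} (hz : z ∈ unitBall n) (hwz : w ≠ z) : 0 < delta w z := by
  have h1 := one_sub_norm_sq_pos hz
  have h2 : 0 < ‖w - z‖ := norm_pos_iff.2 (sub_ne_zero.2 hwz)
  rw [delta_eq]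
  positivity

/-- The elementary inequality behind lower bounds of the kernel in regions where `√Δ` and
`|1 - w z̄|` stay away from `0`. -/
theorem le_rpow_div_rpow {S D : ℝ} (c s : ℝ) (hS : 1 / 4 ≤ S) (hS2 : S ≤ 4) (hD : 1 / 4 ≤ D)
    (hD2 : D ≤ 4) : (4 : ℝ) ^ (-|c| - |s|) ≤ S ^ c / D ^ s := by
  have hD0 : 0 < D := by linarith
  have hS0 : 0 < S := by linarith
  have h1 := rpow_le_of_comparable (k := 4) c one_pos hS0 (by linarith) (by linarith)
  have h2 := rpow_le_of_comparable (k := 4) s hD0 one_pos (by linarith) (by linarith)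
  rw [Real.one_rpow] at h1 h2
  rw [le_div_iff₀ (by positivity), Real.rpow_sub (by norm_num), Real.rpow_neg (by norm_num)]
  calc ((4 : ℝ) ^ |c|)⁻¹ / 4 ^ |s| * D ^ s ≤ ((4 : ℝ) ^ |c|)⁻¹ / 4 ^ |s| * (4 ^ |s| * 1) := by
        gcongr
    _ = ((4 : ℝ) ^ |c|)⁻¹ * 1 := by field_simp
    _ ≤ ((4 : ℝ) ^ |c|)⁻¹ * (4 ^ |c| * S ^ c) := by gcongr
    _ = S ^ c := by field_simp

/-- The kernel dominates the product of its two weights if `|z|` and `|w|` are separated and their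
product stays away from `1`, as when one of them is below `1/4` and the other above `1/2`. -/
theorem kernel_ge_of_separated {n : ℕ} (a b c : ℝ) {z w : Cn n} (hz : z ∈ unitBall n)
    (hw : w ∈ unitBall n) (hsep : 1 / 4 ≤ |‖w‖ - ‖z‖|) (hprod : ‖w‖ * ‖z‖ ≤ 1 / 2) :
    4 ^ (-|c| - |(n : ℝ) + 1 + a + b + c|) * ((1 - ‖z‖ ^ 2) ^ a * (1 - ‖w‖ ^ 2) ^ b) ≤
      kernel n a b c z w := by
  have hz1 := mem_unitBall.1 hz
  have hw1 := mem_unitBall.1 hw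
  have hε := one_sub_norm_sq_pos hz
  have hx := one_sub_norm_sq_pos hw
  have hD := one_sub_le_norm_one_sub_herm w z
  have hD2 := norm_one_sub_herm_le w z
  have hS : 1 / 4 ≤ √(delta w z) :=
    hsep.trans (Real.abs_le_sqrt (sq_norm_sub_norm_le_delta hw1.le hz1.le))
  have hS2 : √(delta w z) ≤ ‖1 - herm w z‖ :=
    Real.sqrt_le_iff.2 ⟨norm_nonneg _, delta_le_sq hw1.le hz1.le⟩
  have h := le_rpow_div_rpow c ((n : ℝ) + 1 + a + b + c) hS (by linarith)
    (by linarith : 1 / 4 ≤ ‖1 - herm w z‖) (by linarith)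
  unfold kernel
  rw [mul_comm, mul_div_assoc]
  gcongr

theorem volume_ball_pos (m : ℕ) {r : ℝ} (hr : 0 < r) :
    0 < volume (Metric.ball (0 : Cn m) r) := Metric.measure_ball_pos _ _ hr

theorem ball_subset_unitBall {m : ℕ} {r : ℝ} (hr : r ≤ 1) :
    Metric.ball (0 : Cn m) r ⊆ unitBall m := Metric.ball_subset_ball hr

theorem lintegral_inner_ball_ne_top (m : ℕ) (s : ℝ) {r : ℝ} (hr : r ≤ 1 / 2) :
    ∫⁻ w in Metric.ball (0 : Cn m) r, ENNReal.ofReal ((1 - ‖w‖ ^ 2) ^ s) ≠ ∞ := by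
  refine ne_top_of_le_ne_top (b := ∫⁻ w in Metric.ball (0 : Cn m) r, ENNReal.ofReal (2 ^ |s|)) ?_
    (setLIntegral_mono' Metric.isOpen_ball.measurableSet fun w hw => ?_)
  · rw [setLIntegral_const]
    exact ENNReal.mul_ne_top ENNReal.ofReal_ne_top measure_ball_lt_top.ne
  · have hw1 : ‖w‖ < 1 / 2 := by simpa using (Metric.ball_subset_ball hr) hw
    refine ENNReal.ofReal_le_ofReal ?_
    have h := rpow_le_of_comparable (k := 2) s (by nlinarith [norm_nonneg w] : 0 < 1 - ‖w‖ ^ 2)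
      one_pos (by nlinarith [norm_nonneg w]) (by nlinarith [norm_nonneg w])
    rwa [Real.one_rpow, mul_one] at h

theorem lintegral_inner_ball_ne_zero (m : ℕ) (s : ℝ) {r : ℝ} (hr0 : 0 < r) (hr : r ≤ 1) :
    ∫⁻ w in Metric.ball (0 : Cn m) r, ENNReal.ofReal ((1 - ‖w‖ ^ 2) ^ s) ≠ 0 := by
  rw [← pos_iff_ne_zero, setLIntegral_pos_iff (by fun_prop)]
  refine lt_of_lt_of_le (volume_ball_pos m hr0) (measure_mono fun w hw => ⟨?_, hw⟩)
  have := one_sub_norm_sq_pos (ball_subset_unitBall hr hw)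
  exact (ENNReal.ofReal_pos.2 (by positivity)).ne'

theorem posT_indicator {n : ℕ} (a b c : ℝ) {s : Set (Cn n)} (hs : MeasurableSet s)
    (hsub : s ⊆ unitBall n) (g : Cn n → ℝ≥0) (z : Cn n) :
    posT n a b c (fun w => (s.indicator g w : ℝ≥0)) z =
      ∫⁻ w in s, ENNReal.ofReal (kernel n a b c z w) * g w := by
  unfold posT
  have h : ∀ w, ENNReal.ofReal (kernel n a b c z w) * ((s.indicator g w : ℝ≥0) : ℝ≥0∞) =
      s.indicator (fun w => ENNReal.ofReal (kernel n a b c z w) * g w) w := fun w => by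
    by_cases hw : w ∈ s <;> simp [hw]
  simp_rw [h]
  rw [setLIntegral_indicator hs, Set.inter_eq_left.2 hsub]

theorem lintegral_indicator_rpow {n : ℕ} {t p : ℝ} (hp : 0 < p) {s : Set (Cn n)}
    (hs : MeasurableSet s) (hsub : s ⊆ unitBall n) (g : Cn n → ℝ≥0) :
    ∫⁻ z, ((s.indicator g z : ℝ≥0) : ℝ≥0∞) ^ p ∂(weightedVolume n t) =
      ∫⁻ w in s, ENNReal.ofReal ((1 - ‖w‖ ^ 2) ^ t) * (g w : ℝ≥0∞) ^ p := by
  rw [lintegral_weightedVolume]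
  have h : ∀ w, ENNReal.ofReal ((1 - ‖w‖ ^ 2) ^ t) * ((s.indicator g w : ℝ≥0) : ℝ≥0∞) ^ p =
      s.indicator (fun w => ENNReal.ofReal ((1 - ‖w‖ ^ 2) ^ t) * (g w : ℝ≥0∞) ^ p) w := fun w => by
    by_cases hw : w ∈ s <;> simp [hw, hp]
  simp_rw [h]
  rw [setLIntegral_indicator hs, Set.inter_eq_left.2 hsub]

section Necessity

variable {m : ℕ} {a b c t p : ℝ} {C : ℝ≥0}

/-- If `c ≤ -2n`, the integral defining `T_{a,b,c} f(z)` diverges at `w = z` already for the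
indicator function `f` of a ball. -/
theorem lt_of_bounded (hp : 1 ≤ p)
    (hC : IsPosBoundedOnLp (m + 1) a b c t p C) :
    -2 * ((m + 1 : ℕ) : ℝ) < c := by
  by_contra hc
  push Not at hc
  have hp0 : 0 < p := by linarith
  have hc0 : c ≤ 0 := hc.trans (by have := Nat.cast_nonneg (α := ℝ) (m + 1); linarith)
  set s := Metric.ball (0 : Cn (m + 1)) (1 / 2) with hs
  have hsm : MeasurableSet s := Metric.isOpen_ball.measurableSet
  have hsub : s ⊆ unitBall (m + 1) := ball_subset_unitBall (by norm_num)
  have h := hC (s.indicator 1) (measurable_one.indicator hsm)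
  rw [lintegral_indicator_rpow hp0 hsm hsub] at h
  have hTm : Measurable (posT (m + 1) a b c fun w => (s.indicator 1 w : ℝ≥0)) :=
    measurable_posT (measurable_one.indicator hsm).coe_nnreal_ennreal
  have hfin := ae_lt_top (hTm.pow_const p) (ne_top_of_le_ne_top (ENNReal.mul_ne_top
    ENNReal.coe_ne_top (by
      simp only [Pi.one_apply, ENNReal.coe_one, ENNReal.one_rpow, mul_one]
      exact lintegral_inner_ball_ne_top (m + 1) t le_rfl)) h)
  have hfin2 : ∀ᵐ z ∂(ballVolume (m + 1)),
      posT (m + 1) a b c (fun w => (s.indicator 1 w : ℝ≥0)) z ^ p < ∞ :=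
    (ballVolume_absolutelyContinuous t).ae_le hfin
  rw [ballVolume, ae_restrict_iff' (measurableSet_unitBall _)] at hfin2
  obtain ⟨z, hz, hzT⟩ : ∃ z ∈ Metric.ball (0 : Cn (m + 1)) (1 / 4),
      posT (m + 1) a b c (fun w => (s.indicator 1 w : ℝ≥0)) z ^ p < ∞ := by
    by_contra hcon
    push Not at hcon
    refine (volume_ball_pos (m + 1) (by norm_num : (0 : ℝ) < 1 / 4)).ne'
      (measure_mono_null (fun z hz => ?_) hfin2)
    exact fun h => absurd (h (ball_subset_unitBall (by norm_num) hz)) (hcon z hz).not_gt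
  refine absurd hzT (not_lt.2 (top_le_iff.2 ?_))
  rw [ENNReal.rpow_eq_top_iff_of_pos hp0, posT_indicator a b c hsm hsub]
  have hzb := ball_subset_unitBall (by norm_num) hz
  have hz4 : ‖z‖ < 1 / 4 := by simpa using hz
  have hε := one_sub_norm_sq_pos hzb
  set k : ℝ := (1 - ‖z‖ ^ 2) ^ a * (4 ^ (-|b| - |((m + 1 : ℕ) : ℝ) + 1 + a + b + c|)) with hk
  have hk0 : 0 < k := by positivity
  rw [← top_le_iff]
  calc (∞ : ℝ≥0∞) = ENNReal.ofReal k *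
        ∫⁻ u in Metric.ball (0 : Cn (m + 1)) (1 / 4), ENNReal.ofReal (‖u‖ ^ c) := by
        rw [lintegral_norm_rpow_eq_top m (by norm_num) hc,
          ENNReal.mul_top (ENNReal.ofReal_pos.2 hk0).ne']
    _ = ENNReal.ofReal k * ∫⁻ w in Metric.ball z (1 / 4), ENNReal.ofReal (‖w - z‖ ^ c) := by
        congr 1
        rw [← lintegral_indicator Metric.isOpen_ball.measurableSet,
          ← lintegral_indicator Metric.isOpen_ball.measurableSet,
          ← lintegral_sub_right_eq_self _ z]
        refine lintegral_congr fun w => ?_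
        by_cases hw : w ∈ Metric.ball z (1 / 4)
        · rw [Set.indicator_of_mem hw, Set.indicator_of_mem (by simpa [dist_eq_norm] using hw)]
        · rw [Set.indicator_of_notMem hw,
            Set.indicator_of_notMem (by simpa [dist_eq_norm] using hw)]
    _ = ∫⁻ w in Metric.ball z (1 / 4), ENNReal.ofReal (k * ‖w - z‖ ^ c) := by
        simp_rw [ENNReal.ofReal_mul hk0.le]
        rw [lintegral_const_mul' _ _ ENNReal.ofReal_ne_top]
    _ ≤ ∫⁻ w in Metric.ball z (1 / 4), ENNReal.ofReal (kernel (m + 1) a b c z w) := by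
        refine setLIntegral_mono_ae' Metric.isOpen_ball.measurableSet ?_
        -- At `w = z` the kernel takes the junk value `0 ^ c`, which has to be discarded.
        have hne : ∀ᵐ w : Cn (m + 1), w ≠ z := by simp [ae_iff]
        filter_upwards [hne] with w hwz hw
        have hw4 : ‖w - z‖ < 1 / 4 := by simpa [dist_eq_norm] using hw
        have hw2 : ‖w‖ < 1 / 2 := by
          have := norm_add_le (w - z) z
          rw [sub_add_cancel] at this
          linarith
        refine ENNReal.ofReal_le_ofReal ?_
        have hx : 3 / 4 ≤ 1 - ‖w‖ ^ 2 := by nlinarith [norm_nonneg w]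
        have hD := one_sub_le_norm_one_sub_herm w z
        have hD2 := norm_one_sub_herm_le w z
        have hprod : ‖w‖ * ‖z‖ ≤ 1 / 2 := by nlinarith [norm_nonneg w, norm_nonneg z]
        have h1 := le_rpow_div_rpow b (((m + 1 : ℕ) : ℝ) + 1 + a + b + c)
          (by linarith : 1 / 4 ≤ 1 - ‖w‖ ^ 2) (by nlinarith [norm_nonneg w])
          (by linarith : 1 / 4 ≤ ‖1 - herm w z‖) (by linarith)
        have h2 : ‖w - z‖ ^ c ≤ √(delta w z) ^ c :=
          Real.rpow_le_rpow_of_nonpos (Real.sqrt_pos.2 (delta_pos hzb hwz))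
            (Real.sqrt_le_iff.2 ⟨norm_nonneg _, delta_le_sq_norm_sub w z⟩) hc0
        calc k * ‖w - z‖ ^ c ≤ (1 - ‖z‖ ^ 2) ^ a * ((1 - ‖w‖ ^ 2) ^ b /
              ‖1 - herm w z‖ ^ (((m + 1 : ℕ) : ℝ) + 1 + a + b + c)) * √(delta w z) ^ c := by
              rw [hk]
              gcongr
          _ = _ := by unfold kernel; ring
    _ ≤ ∫⁻ w in s, ENNReal.ofReal (kernel (m + 1) a b c z w) := by
        refine lintegral_mono_set fun w hw => ?_
        have hw4 : ‖w - z‖ < 1 / 4 := by simpa [dist_eq_norm] using hw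
        have := norm_add_le (w - z) z
        rw [sub_add_cancel] at this
        rw [hs, mem_ball_zero_iff]
        linarith
    _ = _ := by simp

/-- Testing on the indicator function of a ball around `0`, whose image under `T_{a,b,c}` dominates
`(1 - |z|²) ^ a` near the sphere. -/
theorem neg_mul_lt_of_bounded (hp : 1 ≤ p)
    (hC : IsPosBoundedOnLp (m + 1) a b c t p C) :
    -(p * a) < t + 1 := by
  by_contra hcon
  have hp0 : 0 < p := by linarith
  set s := Metric.ball (0 : Cn (m + 1)) (1 / 4) with hs
  have hsm : MeasurableSet s := Metric.isOpen_ball.measurableSet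
  have hsub : s ⊆ unitBall (m + 1) := ball_subset_unitBall (by norm_num)
  have h := hC (s.indicator 1) (measurable_one.indicator hsm)
  rw [lintegral_indicator_rpow hp0 hsm hsub, lintegral_weightedVolume] at h
  set k : ℝ := 4 ^ (-|c| - |((m + 1 : ℕ) : ℝ) + 1 + a + b + c|) with hk
  have hk0 : 0 < k := by positivity
  set M := ∫⁻ w in s, ENNReal.ofReal ((1 - ‖w‖ ^ 2) ^ b) with hM
  have hM0 : M ≠ 0 := lintegral_inner_ball_ne_zero _ _ (by norm_num) (by norm_num)
  have hMt : M ≠ ∞ := lintegral_inner_ball_ne_top _ _ (by norm_num)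
  set k' : ℝ≥0∞ := (ENNReal.ofReal k * M) ^ p with hk'
  have hk'0 : k' ≠ 0 := by
    have h1 : ENNReal.ofReal k * M ≠ 0 := mul_ne_zero (ENNReal.ofReal_pos.2 hk0).ne' hM0
    simp [hk', h1, not_lt.2 hp0.le]
  have hk't : k' ≠ ∞ := ENNReal.rpow_ne_top_of_nonneg hp0.le (by finiteness)
  have hlow : k' * ∫⁻ v : Cn (m + 1), (Set.Ioi (1 / 2)).indicator 1 ‖v‖ *
      posPow (t + p * a) (1 - ‖v‖ ^ 2) ≤
        ∫⁻ z in unitBall (m + 1), ENNReal.ofReal ((1 - ‖z‖ ^ 2) ^ t) *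
          posT (m + 1) a b c (fun w => (s.indicator 1 w : ℝ≥0)) z ^ p := by
    simp_rw [mul_comm _ (posPow _ _)]
    rw [setLIntegral_posPow_eq, ← lintegral_const_mul' _ _ hk't]
    refine setLIntegral_mono' (measurableSet_unitBall _) fun z hz => ?_
    have hε := one_sub_norm_sq_pos hz
    by_cases hz2 : ‖z‖ ∈ Set.Ioi (1 / 2 : ℝ)
    · have hz2' : 1 / 2 < ‖z‖ := hz2
      have hT : ENNReal.ofReal ((1 - ‖z‖ ^ 2) ^ a) * (ENNReal.ofReal k * M) ≤
          posT (m + 1) a b c (fun w => (s.indicator 1 w : ℝ≥0)) z := by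
        rw [posT_indicator a b c hsm hsub, hM, ← mul_assoc, ← lintegral_const_mul' _ _
          (by finiteness), ← ENNReal.ofReal_mul (by positivity)]
        refine setLIntegral_mono' hsm fun w hw => ?_
        have hw4 : ‖w‖ < 1 / 4 := by simpa [hs] using hw
        rw [← ENNReal.ofReal_mul (by positivity), Pi.one_apply, ENNReal.coe_one, mul_one]
        refine ENNReal.ofReal_le_ofReal (le_trans (le_of_eq ?_)
          (kernel_ge_of_separated a b c hz (hsub hw) ?_ ?_))
        · rw [hk]; ring
        · rw [abs_sub_comm]; exact le_abs.2 (Or.inl (by linarith))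
        · nlinarith [norm_nonneg w, norm_nonneg z, mem_unitBall.1 hz]
      rw [Set.indicator_of_mem hz2, Pi.one_apply, mul_one]
      calc k' * ENNReal.ofReal ((1 - ‖z‖ ^ 2) ^ (t + p * a))
          = ENNReal.ofReal ((1 - ‖z‖ ^ 2) ^ t) *
              (ENNReal.ofReal ((1 - ‖z‖ ^ 2) ^ a) * (ENNReal.ofReal k * M)) ^ p := by
            rw [ENNReal.mul_rpow_of_nonneg (ENNReal.ofReal _) _ hp0.le,
              ENNReal.ofReal_rpow_of_pos (by positivity), ← Real.rpow_mul hε.le,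
              Real.rpow_add hε, ENNReal.ofReal_mul (by positivity), hk', mul_comm a p]
            ring
        _ ≤ _ := by gcongr
    · rw [Set.indicator_of_notMem hz2, mul_zero, mul_zero]
      exact zero_le
  rw [lintegral_weight_shell_eq_top m (by linarith), ENNReal.mul_top hk'0] at hlow
  have hrhs : (C : ℝ≥0∞) * ∫⁻ w in s, ENNReal.ofReal ((1 - ‖w‖ ^ 2) ^ t) *
      (((1 : Cn (m + 1) → ℝ≥0) w : ℝ≥0) : ℝ≥0∞) ^ p ≠ ∞ :=
    ENNReal.mul_ne_top ENNReal.coe_ne_top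
      (by
        simp only [Pi.one_apply, ENNReal.coe_one, ENNReal.one_rpow, mul_one]
        exact lintegral_inner_ball_ne_top (m + 1) t (by norm_num))
  exact hrhs (top_le_iff.1 (hlow.trans h))

end Necessity

/-! ### Necessity of the bound on `b` -/

/-- On the cone `|Im l| < 1 - Re l < 1/2` at the boundary point `1`, both `1 - |l|²` and `|1 - l|`
are comparable to `1 - Re l`; the integral diverges there for every exponent. -/
theorem lintegral_disc_eq_top (β : ℝ) :
    ∫⁻ l : ℂ, posPow β (1 - ‖l‖ ^ 2) * ENNReal.ofReal (‖1 - l‖ ^ (-(2 + β))) = ∞ := by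
  set k : ℝ := (2 ^ |β|)⁻¹ * (2 ^ |(-(2 + β))|)⁻¹ with hk
  have hk0 : 0 < k := by positivity
  have hpt : ∀ x ∈ Set.Ioo (1 - 1 / 2 : ℝ) 1, ∀ y ∈ Set.Ioo (-(1 - x)) (1 - x),
      ENNReal.ofReal (k * (1 - x) ^ (-2 : ℝ)) ≤
        posPow β (1 - ‖(⟨x, y⟩ : ℂ)‖ ^ 2) * ENNReal.ofReal (‖1 - (⟨x, y⟩ : ℂ)‖ ^ (-(2 + β))) := by
    rintro x ⟨hx1, hx2⟩ y ⟨hy1, hy2⟩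
    have hu : 0 < 1 - x := by linarith
    have hy : y ^ 2 ≤ (1 - x) ^ 2 := by nlinarith
    have h1 : 1 - ‖(⟨x, y⟩ : ℂ)‖ ^ 2 = 1 - x ^ 2 - y ^ 2 := by
      rw [Complex.sq_norm, Complex.normSq_mk]; ring
    have h2 : ‖1 - (⟨x, y⟩ : ℂ)‖ ^ 2 = (1 - x) ^ 2 + y ^ 2 := by
      rw [Complex.sq_norm, Complex.normSq_apply]
      simp
      ring
    have h3 : 0 < 1 - x ^ 2 - y ^ 2 := by nlinarith
    have h4 : 1 - x ≤ ‖1 - (⟨x, y⟩ : ℂ)‖ :=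
      (pow_le_pow_iff_left₀ hu.le (norm_nonneg _) two_ne_zero).1
        (by rw [h2]; nlinarith [sq_nonneg y])
    have h5 : ‖1 - (⟨x, y⟩ : ℂ)‖ ≤ 2 * (1 - x) :=
      (pow_le_pow_iff_left₀ (norm_nonneg _) (by linarith) two_ne_zero).1
        (by rw [h2]; nlinarith)
    rw [h1, posPow_of_pos h3, ← ENNReal.ofReal_mul (by positivity)]
    refine ENNReal.ofReal_le_ofReal ?_
    have h6 := rpow_le_of_comparable (k := 2) β hu h3 (by nlinarith) (by nlinarith [sq_nonneg y])
    have h7 := rpow_le_of_comparable (k := 2) (-(2 + β)) hu (hu.trans_le h4) (by linarith) h5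
    calc k * (1 - x) ^ (-2 : ℝ)
        = (2 ^ |β|)⁻¹ * (1 - x) ^ β * ((2 ^ |(-(2 + β))|)⁻¹ * (1 - x) ^ (-(2 + β))) := by
          rw [show (-2 : ℝ) = β + -(2 + β) by ring, Real.rpow_add hu, hk]
          ring_nf
      _ ≤ _ := by
          gcongr
          · exact (inv_mul_le_iff₀ (by positivity)).2 h6
          · exact (inv_mul_le_iff₀ (by positivity)).2 h7
  rw [← Complex.volume_preserving_equiv_real_prod.symm.lintegral_comp_emb
    Complex.measurableEquivRealProd.symm.measurableEmbedding, Measure.volume_eq_prod,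
    lintegral_prod _ (by fun_prop), ← top_le_iff]
  calc (∞ : ℝ≥0∞)
      = ENNReal.ofReal (2 * k) *
          ∫⁻ x in Set.Ioo (1 - 1 / 2 : ℝ) 1, ENNReal.ofReal ((1 - x) ^ (-1 : ℝ)) := by
        have h : ∫⁻ x in Set.Ioo (1 - 1 / 2 : ℝ) 1, ENNReal.ofReal ((1 - x) ^ (-1 : ℝ)) = ∞ := by
          by_contra h
          rw [← ne_eq, lintegral_ne_top_iff_integrableOn (by fun_prop)
            (fun x hx => Real.rpow_nonneg (by linarith [hx.2]) _) measurableSet_Ioo,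
            integrableOn_one_sub_rpow_iff (by norm_num)] at h
          exact lt_irrefl _ h
        rw [h, ENNReal.mul_top (ENNReal.ofReal_pos.2 (by positivity)).ne']
    _ = ∫⁻ x in Set.Ioo (1 - 1 / 2 : ℝ) 1, ∫⁻ y in Set.Ioo (-(1 - x)) (1 - x),
          ENNReal.ofReal (k * (1 - x) ^ (-2 : ℝ)) := by
        rw [← lintegral_const_mul' _ _ ENNReal.ofReal_ne_top]
        refine setLIntegral_congr_fun measurableSet_Ioo fun x hx => ?_
        have hu : 0 < 1 - x := by linarith [hx.2]
        rw [setLIntegral_const, Real.volume_Ioo, ← ENNReal.ofReal_mul (by positivity),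
          ← ENNReal.ofReal_mul (by positivity), show (-1 : ℝ) = -2 + 1 by norm_num,
          Real.rpow_add hu, Real.rpow_one]
        congr 1
        ring
    _ ≤ ∫⁻ x in Set.Ioo (1 - 1 / 2 : ℝ) 1, ∫⁻ y : ℝ,
          posPow β (1 - ‖(⟨x, y⟩ : ℂ)‖ ^ 2) *
            ENNReal.ofReal (‖1 - (⟨x, y⟩ : ℂ)‖ ^ (-(2 + β))) :=
        setLIntegral_mono' measurableSet_Ioo fun x hx =>
          (setLIntegral_mono' measurableSet_Ioo (hpt x hx)).trans (setLIntegral_le_lintegral _ _)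
    _ ≤ _ := setLIntegral_le_lintegral _ _

theorem lintegral_ball_eq_top (m : ℕ) (s : ℝ) (e : Cn (m + 1)) (he : ‖e‖ = 1) :
    ∫⁻ z : Cn (m + 1), posPow s (1 - ‖z‖ ^ 2) *
      ENNReal.ofReal (‖1 - herm z e‖ ^ (-(2 + (s + m)))) = ∞ := by
  have hs := lintegral_slice e he (fun q => posPow s (1 - q.2) *
    ENNReal.ofReal (‖1 - q.1‖ ^ (-(2 + (s + m))))) (by fun_prop)
  have hin : ∀ l : ℂ, Measurable fun v : Cn m => posPow s (1 - (‖l‖ ^ 2 + ‖v‖ ^ 2)) :=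
    fun l => by fun_prop
  rw [hs]
  simp_rw [lintegral_mul_const _ (hin _), lintegral_weight_slice]
  have hκ : ∫⁻ v : Cn m, posPow s (1 - ‖v‖ ^ 2) ≠ 0 := by
    have h := setLIntegral_posPow_eq (m := m) s 1
    simp only [Pi.one_apply, mul_one] at h
    rw [h]
    exact lintegral_inner_ball_ne_zero m s one_pos le_rfl
  calc _ = (∫⁻ v : Cn m, posPow s (1 - ‖v‖ ^ 2)) * ∫⁻ l : ℂ, posPow (s + m) (1 - ‖l‖ ^ 2) *
        ENNReal.ofReal (‖1 - l‖ ^ (-(2 + (s + m)))) := by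
        rw [← lintegral_const_mul _ (by fun_prop)]
        refine lintegral_congr fun l => ?_
        ring
    _ = ∞ := by rw [lintegral_disc_eq_top, ENNReal.mul_top hκ]

section Necessity

variable {m : ℕ} {a b c t p : ℝ} {C : ℝ≥0}

/-- The part of the shell `1/2 < |w| < 1` on which `1 - |w|²` exceeds `δ`. -/
def truncatedShell (m : ℕ) (δ : ℝ) : Set (Cn m) :=
  {w | 1 / 2 < ‖w‖ ∧ δ < 1 - ‖w‖ ^ 2}

theorem measurableSet_truncatedShell (m : ℕ) (δ : ℝ) : MeasurableSet (truncatedShell m δ) :=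
  (measurableSet_lt measurable_const measurable_norm).inter
    (measurableSet_lt measurable_const
      (by fun_prop : Measurable fun w : Cn m => 1 - ‖w‖ ^ 2))

theorem truncatedShell_subset (m : ℕ) {δ : ℝ} (hδ : 0 ≤ δ) : truncatedShell m δ ⊆ unitBall m :=
  fun w hw => mem_unitBall.2 (by nlinarith [norm_nonneg w, hw.2])

/-- The truncations of `(1 - |w|²)⁻¹` to `1 - |w|² > δ` have finite integrals, which are unbounded
as `δ` decreases. -/
theorem exists_lt_lintegral_truncatedShell (m : ℕ) {B : ℝ≥0∞} (hB : B ≠ ∞) :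
    ∃ δ : ℝ, 0 < δ ∧
      B < ∫⁻ w in truncatedShell (m + 1) δ, ENNReal.ofReal ((1 - ‖w‖ ^ 2) ^ (-1 : ℝ)) := by
  by_contra! hcon
  set S : ℕ → Set (Cn (m + 1)) := fun k => truncatedShell (m + 1) (1 / ((k : ℝ) + 1)) with hS
  have hmono : Monotone S := fun i j hij w hw =>
    ⟨hw.1, lt_of_le_of_lt (one_div_le_one_div_of_le (by positivity) (by gcongr)) hw.2⟩
  have hU := setLIntegral_iUnion_of_directed (μ := volume)
    (fun w : Cn (m + 1) => ENNReal.ofReal ((1 - ‖w‖ ^ 2) ^ (-1 : ℝ))) hmono.directed_le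
  have hle : ∫⁻ w in ⋃ k, S k, ENNReal.ofReal ((1 - ‖w‖ ^ 2) ^ (-1 : ℝ)) ≤ B := by
    rw [hU]
    exact iSup_le fun k => hcon _ (by positivity)
  refine hB (top_le_iff.1 ?_)
  rw [← lintegral_weight_shell_eq_top m (s := -1) le_rfl]
  refine le_trans ?_ hle
  rw [← lintegral_indicator (MeasurableSet.iUnion fun k => measurableSet_truncatedShell _ _)]
  refine lintegral_mono fun w => ?_
  by_cases hw : ‖w‖ ∈ Set.Ioi (1 / 2 : ℝ)
  · rcases lt_or_ge 0 (1 - ‖w‖ ^ 2) with hx | hx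
    · obtain ⟨k, hk⟩ := exists_nat_one_div_lt hx
      rw [Set.indicator_of_mem hw, Pi.one_apply, one_mul, posPow_of_pos hx,
        Set.indicator_of_mem (Set.mem_iUnion.2 ⟨k, (⟨hw, hk⟩ : w ∈ truncatedShell (m + 1) _)⟩)]
    · rw [posPow_of_nonpos hx, mul_zero]
      exact zero_le
  · rw [Set.indicator_of_notMem hw, zero_mul]
    exact zero_le

theorem lintegral_truncatedShell_ne_top (m : ℕ) {δ : ℝ} (hδ : 0 < δ) :
    ∫⁻ w in truncatedShell m δ, ENNReal.ofReal ((1 - ‖w‖ ^ 2) ^ (-1 : ℝ)) ≠ ∞ := by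
  refine ne_top_of_le_ne_top (b := ∫⁻ w in truncatedShell m δ, ENNReal.ofReal (δ ^ (-1 : ℝ))) ?_
    (setLIntegral_mono' (measurableSet_truncatedShell m δ) fun w hw =>
      ENNReal.ofReal_le_ofReal (Real.rpow_le_rpow_of_nonpos hδ hw.2.le (by norm_num)))
  rw [setLIntegral_const]
  exact ENNReal.mul_ne_top ENNReal.ofReal_ne_top (ne_top_of_le_ne_top
    (measure_ball_lt_top (x := (0 : Cn m)) (r := 1)).ne
    (measure_mono (truncatedShell_subset m hδ.le)))

/-- For `p > 1`, test on `(1 - |w|²) ^ (-(b + 1))` truncated at `1 - |w|² > δ`. With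
`L = ∫ (1 - |w|²)⁻¹` over the truncated shell, `T_{a,b,c} g` is at least a multiple of `L` near
`0`, whereas `‖g‖ ^ p` is at most `L`. -/
theorem lt_mul_of_bounded_of_one_lt (hp : 1 < p)
    (hC : IsPosBoundedOnLp (m + 1) a b c t p C) :
    t + 1 < p * (b + 1) := by
  by_contra! hcon
  have hp0 : 0 < p := by linarith
  have hpm : 0 < p - 1 := by linarith
  set k : ℝ := 4 ^ (-|c| - |((m + 1 : ℕ) : ℝ) + 1 + a + b + c|) with hk
  have hk0 : 0 < k := by positivity
  set ball4 := Metric.ball (0 : Cn (m + 1)) (1 / 4) with hball4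
  have hsub4 : ball4 ⊆ unitBall (m + 1) := ball_subset_unitBall (by norm_num)
  set M := ENNReal.ofReal (k ^ p) *
    ∫⁻ z in ball4, ENNReal.ofReal ((1 - ‖z‖ ^ 2) ^ (t + p * a)) with hM
  have hM0 : M ≠ 0 := mul_ne_zero (ENNReal.ofReal_pos.2 (by positivity)).ne'
    (lintegral_inner_ball_ne_zero _ _ (by norm_num) (by norm_num))
  have hMt : M ≠ ∞ := ENNReal.mul_ne_top ENNReal.ofReal_ne_top
    (lintegral_inner_ball_ne_top _ _ (by norm_num))
  obtain ⟨δ, hδ, hL⟩ := exists_lt_lintegral_truncatedShell m (B := ((C : ℝ≥0∞) / M) ^ (1 / (p - 1)))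
    (ENNReal.rpow_ne_top_of_nonneg (by positivity) (ENNReal.div_ne_top ENNReal.coe_ne_top hM0))
  have hLt := lintegral_truncatedShell_ne_top (m + 1) hδ
  set s := truncatedShell (m + 1) δ with hs
  have hsm : MeasurableSet s := measurableSet_truncatedShell _ _
  have hsub : s ⊆ unitBall (m + 1) := truncatedShell_subset _ hδ.le
  set L := ∫⁻ w in s, ENNReal.ofReal ((1 - ‖w‖ ^ 2) ^ (-1 : ℝ)) with hLdef
  have hL0 : L ≠ 0 := (bot_le.trans_lt hL).ne'
  set g : Cn (m + 1) → ℝ≥0 := fun w => ((1 - ‖w‖ ^ 2) ^ (-(b + 1))).toNNReal with hg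
  have hgm : Measurable g := by fun_prop
  have h := hC (s.indicator g) (hgm.indicator hsm)
  rw [lintegral_indicator_rpow hp0 hsm hsub, lintegral_weightedVolume] at h
  have hup : ∫⁻ w in s, ENNReal.ofReal ((1 - ‖w‖ ^ 2) ^ t) * (g w : ℝ≥0∞) ^ p ≤ L := by
    refine setLIntegral_mono' hsm fun w hw => ?_
    have hx := one_sub_norm_sq_pos (hsub hw)
    have hx1 : 1 - ‖w‖ ^ 2 ≤ 1 := by linarith [sq_nonneg ‖w‖]
    change _ * ENNReal.ofReal _ ^ p ≤ _
    rw [ENNReal.ofReal_rpow_of_pos (by positivity), ← Real.rpow_mul hx.le,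
      ← ENNReal.ofReal_mul (by positivity), ← Real.rpow_add hx]
    exact ENNReal.ofReal_le_ofReal (Real.rpow_le_rpow_of_exponent_ge hx hx1 (by linarith))
  have hT : ∀ z ∈ ball4, ENNReal.ofReal (k * (1 - ‖z‖ ^ 2) ^ a) * L ≤
      posT (m + 1) a b c (fun w => (s.indicator g w : ℝ≥0)) z := fun z hz => by
    have hε := one_sub_norm_sq_pos (hsub4 hz)
    have hz4 : ‖z‖ < 1 / 4 := by simpa [hball4] using hz
    rw [posT_indicator a b c hsm hsub, hLdef, ← lintegral_const_mul' _ _ ENNReal.ofReal_ne_top]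
    refine setLIntegral_mono' hsm fun w hw => ?_
    have hx := one_sub_norm_sq_pos (hsub hw)
    have hw2 : 1 / 2 < ‖w‖ := hw.1
    have hker := kernel_ge_of_separated a b c (hsub4 hz) (hsub hw) (le_abs.2 (Or.inl (by linarith)))
      (by nlinarith [norm_nonneg w, norm_nonneg z, mem_unitBall.1 (hsub hw)])
    change _ ≤ _ * ENNReal.ofReal _
    rw [← ENNReal.ofReal_mul (by positivity),
      ← ENNReal.ofReal_mul (kernel_nonneg (hsub4 hz) (hsub hw))]
    refine ENNReal.ofReal_le_ofReal ?_
    calc k * (1 - ‖z‖ ^ 2) ^ a * (1 - ‖w‖ ^ 2) ^ (-1 : ℝ)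
        = k * ((1 - ‖z‖ ^ 2) ^ a * (1 - ‖w‖ ^ 2) ^ b) * (1 - ‖w‖ ^ 2) ^ (-(b + 1)) := by
          rw [show (-1 : ℝ) = b + -(b + 1) by ring, Real.rpow_add hx]
          ring
      _ ≤ _ := by gcongr
  have hlow : M * L ^ p ≤ ∫⁻ z in unitBall (m + 1), ENNReal.ofReal ((1 - ‖z‖ ^ 2) ^ t) *
      posT (m + 1) a b c (fun w => (s.indicator g w : ℝ≥0)) z ^ p := by
    refine le_trans ?_ (lintegral_mono_set hsub4)
    rw [hM, ← lintegral_const_mul' _ _ ENNReal.ofReal_ne_top,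
      ← lintegral_mul_const' _ _ (ENNReal.rpow_ne_top_of_nonneg hp0.le hLt)]
    refine setLIntegral_mono' Metric.isOpen_ball.measurableSet fun z hz => ?_
    have hε := one_sub_norm_sq_pos (hsub4 hz)
    calc _ = ENNReal.ofReal ((1 - ‖z‖ ^ 2) ^ t) *
          (ENNReal.ofReal (k * (1 - ‖z‖ ^ 2) ^ a) * L) ^ p := by
          rw [ENNReal.mul_rpow_of_nonneg _ _ hp0.le, ENNReal.ofReal_rpow_of_pos (by positivity),
            Real.mul_rpow hk0.le (by positivity), ← Real.rpow_mul hε.le, Real.rpow_add hε,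
            ENNReal.ofReal_mul (by positivity), ENNReal.ofReal_mul (by positivity), mul_comm a p]
          ring
      _ ≤ _ := by
          gcongr
          exact hT z hz
  have hfinal : M * L ^ p ≤ C * L := hlow.trans (h.trans (by gcongr))
  have h1 : M * L ^ (p - 1) ≤ C := by
    rw [show p = (p - 1) + 1 by ring, ENNReal.rpow_add _ _ hL0 hLt, ENNReal.rpow_one,
      ← mul_assoc] at hfinal
    exact (ENNReal.mul_le_mul_iff_left hL0 hLt).1 hfinal
  have h2 : L ^ (p - 1) ≤ C / M := by
    rw [ENNReal.le_div_iff_mul_le (Or.inl hM0) (Or.inl hMt), mul_comm]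
    exact h1
  have h3 : L ≤ ((C : ℝ≥0∞) / M) ^ (1 / (p - 1)) := by
    have := ENNReal.rpow_le_rpow h2 (by positivity : (0 : ℝ) ≤ 1 / (p - 1))
    rwa [← ENNReal.rpow_mul, mul_one_div_cancel hpm.ne', ENNReal.rpow_one] at this
  exact absurd hL (not_lt.2 h3)

/-- Boundedness on the weighted `L¹` space gives a pointwise bound of the adjoint operator applied
to the weight. -/
theorem ae_posT_weight_le
    (hC : IsPosBoundedOnLp (m + 1) a b c t 1 C) :
    ∀ᵐ w ∂(ballVolume (m + 1)),
      posT (m + 1) b a c (fun z => ENNReal.ofReal ((1 - ‖z‖ ^ 2) ^ t)) w ≤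
        C * ENNReal.ofReal ((1 - ‖w‖ ^ 2) ^ t) := by
  refine ae_le_of_forall_setLIntegral_le_of_sigmaFinite (measurable_posT (by fun_prop))
    fun s hs _ => ?_
  have hsb : MeasurableSet (s ∩ unitBall (m + 1)) := hs.inter (measurableSet_unitBall _)
  have hsub : s ∩ unitBall (m + 1) ⊆ unitBall (m + 1) := Set.inter_subset_right
  have h := hC ((s ∩ unitBall (m + 1)).indicator 1) (measurable_one.indicator hsb)
  rw [lintegral_indicator_rpow one_pos hsb hsub, lintegral_weightedVolume] at h
  simp_rw [posT_indicator a b c hsb hsub] at h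
  simp only [ENNReal.rpow_one, Pi.one_apply, ENNReal.coe_one, mul_one] at h
  have hKm : Measurable fun q : Cn (m + 1) × Cn (m + 1) =>
      ENNReal.ofReal (kernel (m + 1) a b c q.1 q.2) := measurable_kernel.ennreal_ofReal
  unfold ballVolume
  rw [Measure.restrict_restrict hs, lintegral_const_mul' _ _ ENNReal.coe_ne_top]
  refine le_trans (le_of_eq ?_) h
  simp_rw [← lintegral_const_mul' _ _ ENNReal.ofReal_ne_top]
  rw [lintegral_lintegral_swap]
  · refine lintegral_congr fun w => lintegral_congr fun z => ?_
    rw [kernel_comm a b c z w, mul_comm]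
  · exact Measurable.aemeasurable (Measurable.mul (by fun_prop) hKm)

/-- For `p = 1` and `t + 1 ≥ b + 1`, the bound on the adjoint fails at the boundary: by Fatou's
lemma it would survive in the limit `w → e` with `|e| = 1`, where the integral diverges. -/
theorem lt_of_bounded_one
    (hC : IsPosBoundedOnLp (m + 1) a b c t 1 C) :
    t < b := by
  by_contra! htb
  have hae := ae_posT_weight_le hC
  set e : Cn (m + 1) := EuclideanSpace.single 0 1 with he
  have he1 : ‖e‖ = 1 := by simp [he]
  set N : ℝ := ((m + 1 : ℕ) : ℝ) + 1 + b + a + c with hN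
  set G : Set (Cn (m + 1)) := {w | w ∈ unitBall (m + 1) ∧
    posT (m + 1) b a c (fun z => ENNReal.ofReal ((1 - ‖z‖ ^ 2) ^ t)) w ≤
      C * ENNReal.ofReal ((1 - ‖w‖ ^ 2) ^ t)} with hG
  rw [ballVolume, ae_restrict_iff' (measurableSet_unitBall _)] at hae
  have hcl : e ∈ closure G := by
    have h1 : e ∈ closure (unitBall (m + 1)) := by
      rw [unitBall, closure_ball _ one_ne_zero]
      simp [he1]
    rw [mem_closure_iff] at h1 ⊢
    intro o ho heo
    obtain ⟨w, hw⟩ := h1 o ho heo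
    have hpos : 0 < volume (o ∩ unitBall (m + 1)) :=
      (ho.inter Metric.isOpen_ball).measure_pos _ ⟨w, hw⟩
    by_contra hemp
    refine hpos.ne' (measure_mono_null (fun v hv => ?_) hae)
    exact fun hvi => hemp ⟨v, hv.1, hv.2, hvi hv.2⟩
  have hne : (nhdsWithin e G).NeBot := mem_closure_iff_nhdsWithin_neBot.1 hcl
  -- On `|z| ≤ |w|` the assumption `b ≤ t` allows replacing the weights by `(1 - |z|²) ^ (a + b)`.
  set f : Cn (m + 1) → Cn (m + 1) → ℝ≥0∞ := fun w z =>
    if ‖z‖ ≤ ‖w‖ then ENNReal.ofReal ((1 - ‖z‖ ^ 2) ^ (a + b) *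
      (√(delta z w) ^ c / ‖1 - herm z w‖ ^ N)) else 0 with hf
  have hfm : ∀ w, Measurable (f w) := fun w => by
    refine Measurable.ite (measurableSet_le measurable_norm measurable_const) ?_ measurable_const
    unfold delta
    fun_prop
  have hbound : ∀ w ∈ G, ∫⁻ z in unitBall (m + 1), f w z ≤ C := by
    rintro w ⟨hw, hwC⟩
    have hx := one_sub_norm_sq_pos hw
    have hxt : ENNReal.ofReal ((1 - ‖w‖ ^ 2) ^ t) ≠ 0 := (ENNReal.ofReal_pos.2 (by positivity)).ne'
    refine (ENNReal.mul_le_mul_iff_left hxt ENNReal.ofReal_ne_top).1 (le_trans ?_ hwC)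
    rw [← lintegral_mul_const' _ _ ENNReal.ofReal_ne_top]
    refine setLIntegral_mono' (measurableSet_unitBall _) fun z hz => ?_
    have hε := one_sub_norm_sq_pos hz
    by_cases hzw : ‖z‖ ≤ ‖w‖
    · simp only [hf, if_pos hzw]
      rw [← ENNReal.ofReal_mul (by positivity), ← ENNReal.ofReal_mul (kernel_nonneg hw hz)]
      refine ENNReal.ofReal_le_ofReal ?_
      have hmono : (1 - ‖w‖ ^ 2) ^ (t - b) ≤ (1 - ‖z‖ ^ 2) ^ (t - b) :=
        Real.rpow_le_rpow hx.le (by nlinarith [norm_nonneg z]) (by linarith)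
      calc (1 - ‖z‖ ^ 2) ^ (a + b) * (√(delta z w) ^ c / ‖1 - herm z w‖ ^ N) * (1 - ‖w‖ ^ 2) ^ t
          = (1 - ‖z‖ ^ 2) ^ (a + b) * (√(delta z w) ^ c / ‖1 - herm z w‖ ^ N) *
              ((1 - ‖w‖ ^ 2) ^ b * (1 - ‖w‖ ^ 2) ^ (t - b)) := by
            rw [← Real.rpow_add hx, add_sub_cancel]
        _ ≤ (1 - ‖z‖ ^ 2) ^ (a + b) * (√(delta z w) ^ c / ‖1 - herm z w‖ ^ N) *
              ((1 - ‖w‖ ^ 2) ^ b * (1 - ‖z‖ ^ 2) ^ (t - b)) := by gcongr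
        _ = (1 - ‖w‖ ^ 2) ^ b * ((1 - ‖z‖ ^ 2) ^ (a + b) * (1 - ‖z‖ ^ 2) ^ (t - b)) *
              (√(delta z w) ^ c / ‖1 - herm z w‖ ^ N) := by ring
        _ = (1 - ‖w‖ ^ 2) ^ b * ((1 - ‖z‖ ^ 2) ^ a * (1 - ‖z‖ ^ 2) ^ t) *
              (√(delta z w) ^ c / ‖1 - herm z w‖ ^ N) := by
            rw [← Real.rpow_add hε, ← Real.rpow_add hε]
            congr 3
            ring
        _ = _ := by
            unfold kernel
            ring
    · simp only [hf, if_neg hzw, zero_mul]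
      exact zero_le
  have hlim : ∀ z ∈ unitBall (m + 1), Filter.liminf (fun w => f w z) (nhdsWithin e G) =
      ENNReal.ofReal ((1 - ‖z‖ ^ 2) ^ (a + b)) *
        ENNReal.ofReal (‖1 - herm z e‖ ^ (-(2 + (a + b + m)))) := fun z hz => by
    have hz1 := mem_unitBall.1 hz
    have hε := one_sub_norm_sq_pos hz
    have hD : 0 < ‖1 - herm z e‖ := by
      rw [norm_one_sub_herm_comm]; exact norm_one_sub_herm_pos he1.le hz1
    have hΔ : √(delta z e) = ‖1 - herm z e‖ := by
      unfold delta
      rw [he1, one_pow, sub_self, mul_zero, sub_zero, Real.sqrt_sq hD.le]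
    refine Filter.Tendsto.liminf_eq ?_
    have hev : ∀ᶠ w in nhdsWithin e G, f w z = ENNReal.ofReal ((1 - ‖z‖ ^ 2) ^ (a + b) *
        (√(delta z w) ^ c / ‖1 - herm z w‖ ^ N)) := by
      have : ∀ᶠ w in nhds e, ‖z‖ < ‖w‖ :=
        continuous_norm.continuousAt.eventually (lt_mem_nhds (hz1.trans_eq he1.symm))
      filter_upwards [nhdsWithin_le_nhds this] with w hw
      simp only [hf, if_pos hw.le]
    refine Filter.Tendsto.congr' (Filter.EventuallyEq.symm hev) ?_
    have hval : ENNReal.ofReal ((1 - ‖z‖ ^ 2) ^ (a + b)) *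
        ENNReal.ofReal (‖1 - herm z e‖ ^ (-(2 + (a + b + m)))) =
          ENNReal.ofReal ((1 - ‖z‖ ^ 2) ^ (a + b) * (√(delta z e) ^ c / ‖1 - herm z e‖ ^ N)) := by
      rw [← ENNReal.ofReal_mul (by positivity), hΔ, ← Real.rpow_sub hD]
      congr 3
      rw [hN]
      push_cast
      ring
    rw [hval]
    have hherm : Continuous fun w : Cn (m + 1) => herm z w := by unfold herm; fun_prop
    have hdelta : Continuous fun w : Cn (m + 1) => √(delta z w) := by unfold delta; fun_prop
    refine ENNReal.tendsto_ofReal (Filter.Tendsto.mono_left ?_ nhdsWithin_le_nhds)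
    refine Filter.Tendsto.const_mul _ (Filter.Tendsto.div ?_ ?_ (by positivity))
    · exact hdelta.continuousAt.tendsto.rpow_const (Or.inl (by rw [hΔ]; exact hD.ne'))
    · exact (by fun_prop : Continuous fun w : Cn (m + 1) =>
        ‖1 - herm z w‖).continuousAt.tendsto.rpow_const (Or.inl hD.ne')
  have hfatou := lintegral_liminf_le (μ := volume.restrict (unitBall (m + 1)))
    (u := nhdsWithin e G) hfm
  have hC' : Filter.liminf (fun w => ∫⁻ z in unitBall (m + 1), f w z) (nhdsWithin e G) ≤ C := by
    refine Filter.liminf_le_of_frequently_le' (Filter.Eventually.frequently ?_)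
    filter_upwards [self_mem_nhdsWithin] with w hw
    exact hbound w hw
  rw [setLIntegral_congr_fun (measurableSet_unitBall _) hlim, ← setLIntegral_posPow_eq,
    lintegral_ball_eq_top m (a + b) e he1] at hfatou
  exact ENNReal.coe_ne_top (top_le_iff.1 (hfatou.trans hC'))

end Necessity

end BallKernel

theorem lemma6p1 (n : ℕ) (hn : 1 ≤ n) (a b c t p : ℝ) (hp : 1 ≤ p) :
    BallKernel.IsBoundedOnLp n a b c t p ↔
      -2 * (n : ℝ) < c ∧ -(p * a) < t + 1 ∧ t + 1 < p * (b + 1) := by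
  obtain ⟨m, rfl⟩ := Nat.exists_eq_add_of_le' hn
  constructor
  · intro h
    obtain ⟨C, hC⟩ := (BallKernel.isBoundedOnLp_iff hp).1 h
    refine ⟨BallKernel.lt_of_bounded hp hC, BallKernel.neg_mul_lt_of_bounded hp hC, ?_⟩
    rcases hp.eq_or_lt with rfl | hp1
    · linarith [BallKernel.lt_of_bounded_one hC]
    · exact BallKernel.lt_mul_of_bounded_of_one_lt hp1 hC
  · rintro ⟨hc, ha, hb⟩
    exact BallKernel.isBoundedOnLp_of_conditions m hp hc ha hb
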